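/- Let $d\ge 2$. A *$(2,2,2)$-behaviour* is a table $p(a,b|r,t)$ with outcomes $a,b$ and settings $r,t$ each taking two values. It is *quantum* if there are finite-dimensional complex Hilbert spaces $H_A,H_B$, a density operator $\rho$ on $H_A\otimes H_B$, two two-outcome POVMs $(E_r^a)_a$ on $H_A$ and two two-outcome POVMs $(F_t^b)_b$ on $H_B$ with $p(a,b|r,t)=\operatorname{tr}[\rho\,(E_r^a\otimes F_t^b)]$ for all $a,b,r,t$. A *binary-outcome bipartite $SO(d)\times SO(d)$-box* is a no-signalling family of probability distributions $P(a,b|\vec x,\vec y)$ with two-valued outcomes $a,b$ and inputs $\vec x,\vec y\in S^{d-1}$, on which $SO(d)$ acts by rotations. No-signalling means that $P_A(a|\vec x)=\sum_b P(a,b|\vec x,\vec y)$ does not depend on $\vec y$ and $P_B(b|\vec y)=\sum_a P(a,b|\vec x,\vec y)$ does not depend on $\vec x$. Its conditional boxes are $$P_A^{b,\vec y}(a|\vec x)=\frac{P(a,b|\vec x,\vec y)}{P_B(b|\vec y)},\qquad P_B^{a,\vec x}(b|\vec y)=\frac{P(a,b|\vec x,\vec y)}{P_A(a|\vec x)},$$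 for fixed $(b,\vec y)$ with $P_B(b|\vec y)>0$ and fixed $(a,\vec x)$ with $P_A(a|\vec x)>0$, respectively. The box *transforms fundamentally locally* if each conditional box $Q$ transforms fundamentally: for every default input $\vec x_0\in S^{d-1}$ there are constants $c_0^a,c_{ij}^a\in\mathbb R$ such that $Q(a|R\vec x_0)=c_0^a+\sum_{i,j=1}^d R_{ij}\,c_{ij}^a$ for all $R\in SO(d)$ and all $a$. (Equivalently, $Q(a|\vec x)$ is affine in $\vec x$.) It is *locally unbiased* if each conditional box $Q$ is unbiased: for every $\vec x\in S^{d-1}$ the average of $Q(a|R\vec x)$ over $R\in SO(d)$ with respect to Haar measure is the same for both outcomes $a$. **Theorem.** The quantum $(2,2,2)$-behaviours are exactly the statistical mixtures by shared randomness, i.e. the finite convex combinations $$p(a,b|r,t)=\sum_{k=1}^N w_k\,P_k(a,b|\vec x^{(k)}_r,\vec y^{(k)}_t),\qquad w_k\ge 0,\quad \sum_{k=1}^N w_k=1,$$ where each $P_k$ is a binary-outcome bipartite $SO(d)\times SO(d)$-box that transforms fundamentally locally and is locally unbiased, and where, for each box $P_k$, $\vec x^{(k)}_1,\vec x^{(k)}_2\in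 S^{d-1}$ and $\vec y^{(k)}_1,\vec y^{(k)}_2\in S^{d-1}$ are two (not necessarily distinct) choices of input direction for each party. -/

import Mathlib

open MeasureTheory
open scoped Matrix Kronecker ComplexOrder

noncomputable section

/-! ### Bipartite behaviours and boxes

A bipartite box with input sets `X`, `Y` and finite outcome sets `A`, `B` is a family of
conditional probabilities `P a b x y = P(a, b | x, y)`. -/

/-- `P a b x y = P(a, b | x, y)` is a bipartite no-signalling box: for every pair of inputs a
probability distribution over the pairs of outcomes, such that the marginal distribution of either
party does not depend on the input of the other party. -/
structure IsNoSignallingBox {A B X Y : Type*} [Fintype A] [Fintype B]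
    (P : A → B → X → Y → ℝ) : Prop where
  nonneg : ∀ a b x y, 0 ≤ P a b x y
  sum_eq_one : ∀ x y, ∑ a, ∑ b, P a b x y = 1
  noSignal_A : ∀ a x y y', ∑ b, P a b x y = ∑ b, P a b x y'
  noSignal_B : ∀ b y x x', ∑ a, P a b x y = ∑ a, P a b x' y

/-- Alice's marginal `P_A(a | x) = ∑ b, P(a, b | x, y)`; for a no-signalling box it does not depend
on `y`. -/
def marginalA {A B X Y : Type*} [Fintype B] (P : A → B → X → Y → ℝ) (y : Y) (a : A) (x : X) : ℝ :=
  ∑ b, P a b x y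

/-- Bob's marginal `P_B(b | y) = ∑ a, P(a, b | x, y)`; for a no-signalling box it does not depend
on `x`. -/
def marginalB {A B X Y : Type*} [Fintype A] (P : A → B → X → Y → ℝ) (x : X) (b : B) (y : Y) : ℝ :=
  ∑ a, P a b x y

/-- Alice's conditional box `P_A^{b,y}(a | x) = P(a, b | x, y) / P_B(b | y)`, for fixed `b, y` with
`P_B(b | y) > 0`. -/
def condBoxA {A B X Y : Type*} [Fintype A] (P : A → B → X → Y → ℝ) (b : B) (y : Y) :
    A → X → ℝ :=
  fun a x => P a b x y / marginalB P x b y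

/-- Bob's conditional box `P_B^{a,x}(b | y) = P(a, b | x, y) / P_A(a | x)`, for fixed `a, x` with
`P_A(a | x) > 0`. -/
def condBoxB {A B X Y : Type*} [Fintype B] (P : A → B → X → Y → ℝ) (a : A) (x : X) :
    B → Y → ℝ :=
  fun b y => P a b x y / marginalA P y a x

/-- All (defined) conditional boxes of `P` for Alice have the property `propA` and all (defined)
conditional boxes for Bob have the property `propB`. -/
def AllConditionalBoxes {A B X Y : Type*} [Fintype A] [Fintype B]
    (propA : (A → X → ℝ) → Prop) (propB : (B → Y → ℝ) → Prop) (P : A → B → X → Y → ℝ) : Prop :=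
  (∀ b y, (∀ x, 0 < marginalB P x b y) → propA (condBoxA P b y)) ∧
    (∀ a x, (∀ y, 0 < marginalA P y a x) → propB (condBoxB P a x))

/-! ### Rotations acting on directions -/

/-- The set `S^{d-1}` of directions in `d`-dimensional Euclidean space. -/
abbrev Direction (d : ℕ) : Type := Metric.sphere (0 : EuclideanSpace ℝ (Fin d)) 1

/-- The rotation group `SO(d)`, as a group of matrices, with the topology of matrices. -/
abbrev Rotation (d : ℕ) : Type := Matrix.specialOrthogonalGroup (Fin d) ℝ

theorem rotation_transpose_mul {d : ℕ} (R : Rotation d) : R.1ᵀ * R.1 = 1 :=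
  (Matrix.mem_orthogonalGroup_iff' (Fin d) ℝ).1
    ((Matrix.mem_specialOrthogonalGroup_iff).1 R.2).1

theorem norm_toLp_rotation_mulVec {d : ℕ} (R : Rotation d) (x : EuclideanSpace ℝ (Fin d)) :
    ‖WithLp.toLp 2 (R.1 *ᵥ x.ofLp)‖ = ‖x‖ := by
  have h : (R.1 *ᵥ x.ofLp) ⬝ᵥ (R.1 *ᵥ x.ofLp) = x.ofLp ⬝ᵥ x.ofLp := by
    rw [Matrix.dotProduct_mulVec, Matrix.vecMul_mulVec, rotation_transpose_mul, Matrix.vecMul_one]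
  rw [EuclideanSpace.norm_eq, EuclideanSpace.norm_eq]
  congr 1
  simpa [dotProduct, sq] using h

/-- The action of a rotation `R` on a direction `x`, by multiplication of the matrix `R` with the
vector `x`. -/
def rotate {d : ℕ} (R : Rotation d) (x : Direction d) : Direction d :=
  ⟨WithLp.toLp 2 (R.1 *ᵥ x.1.ofLp), by
    rw [mem_sphere_zero_iff_norm, norm_toLp_rotation_mulVec]
    exact mem_sphere_zero_iff_norm.1 x.2⟩

instance instIsTopologicalGroupRotation (d : ℕ) : IsTopologicalGroup (Rotation d) where
  continuous_mul := by
    refine Continuous.subtype_mk ?_ _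
    exact (continuous_subtype_val.comp continuous_fst).mul
      (continuous_subtype_val.comp continuous_snd)
  continuous_inv := by
    refine Continuous.subtype_mk ?_ _
    exact continuous_subtype_val.matrix_transpose

instance instCompactSpaceRotation (d : ℕ) : CompactSpace (Rotation d) := by
  apply isCompact_iff_compactSpace.1
  have hK : IsCompact (Set.univ.pi fun _ : Fin d => Set.univ.pi fun _ : Fin d =>
      Set.Icc (-1 : ℝ) 1) :=
    isCompact_univ_pi fun _ => isCompact_univ_pi fun _ => isCompact_Icc
  refine hK.of_isClosed_subset ?_ ?_
  · have : ((Matrix.specialOrthogonalGroup (Fin d) ℝ : Submonoid _) :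
        Set (Matrix (Fin d) (Fin d) ℝ)) = {M | M * Mᵀ = 1} ∩ {M | M.det = 1} := by
      ext M
      simp [Matrix.mem_specialOrthogonalGroup_iff, Matrix.mem_orthogonalGroup_iff]
    rw [this]
    refine IsClosed.inter ?_ ?_
    · exact isClosed_eq (continuous_id.matrix_mul continuous_id.matrix_transpose)
        continuous_const
    · exact isClosed_eq continuous_id.matrix_det continuous_const
  · intro M hM i _ j _
    have h := ((Matrix.mem_specialOrthogonalGroup_iff).1 hM).1
    have h2 : ‖M i j‖ ≤ 1 := entry_norm_bound_of_unitary (𝕜 := ℝ) h i j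
    exact abs_le.1 h2

/-- `SO(d)` carries its Borel σ-algebra. -/
instance instMeasurableSpaceRotation (d : ℕ) : MeasurableSpace (Rotation d) := borel _

instance instBorelSpaceRotation (d : ℕ) : BorelSpace (Rotation d) := ⟨rfl⟩

/-- The Haar measure of `SO(d)`, normalised to total mass one. -/
def rotationHaar (d : ℕ) : Measure (Rotation d) := Measure.haarMeasure ⊤

/-! ### Boxes that transform fundamentally, and unbiased boxes -/

/-- The box `P(a | x)` with inputs `x ∈ S^{d-1}` transforms fundamentally under rotations: for a
default input `x₀`, and for each outcome `a`, the probability `P(a | R x₀)` is a constant plus a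
fixed linear combination of the matrix entries of `R`, for all `R ∈ SO(d)`. (As `SO(d)` acts
transitively on the directions for `d ≥ 2`, it does not matter which `x₀` is taken.) -/
def TransformsFundamentally {d : ℕ} {A : Type*} (P : A → Direction d → ℝ) : Prop :=
  ∀ x₀ : Direction d, ∃ (c₀ : A → ℝ) (c : A → Fin d → Fin d → ℝ),
    ∀ (x : Direction d) (R : Rotation d), rotate R x₀ = x →
      ∀ a, P a x = c₀ a + ∑ i, ∑ j, R.1 i j * c a i j

/-- The box `P(a | x)` with inputs `x ∈ S^{d-1}` is unbiased: the Haar average of `P(a | R x)` over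
`R ∈ SO(d)` (exists and) is the same for all outcomes `a`. -/
def Unbiased {d : ℕ} {A : Type*} (P : A → Direction d → ℝ) : Prop :=
  ∀ x : Direction d,
    (∀ a, Integrable (fun R : Rotation d => P a (rotate R x)) (rotationHaar d)) ∧
      ∀ a a', ∫ R, P a (rotate R x) ∂(rotationHaar d) = ∫ R, P a' (rotate R x) ∂(rotationHaar d)

/-- The bipartite box transforms fundamentally locally: all its conditional boxes transform
fundamentally. -/
def TransformsFundamentallyLocally {d : ℕ} {A B : Type*} [Fintype A] [Fintype B]
    (P : A → B → Direction d → Direction d → ℝ) : Prop :=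
  AllConditionalBoxes TransformsFundamentally TransformsFundamentally P

/-- The bipartite box is locally unbiased: all its conditional boxes are unbiased. -/
def LocallyUnbiased {d : ℕ} {A B : Type*} [Fintype A] [Fintype B]
    (P : A → B → Direction d → Direction d → ℝ) : Prop :=
  AllConditionalBoxes Unbiased Unbiased P

/-! ### `(2,2,2)`-behaviours -/

/-- A table `p a b r t = p(a, b | r, t)` of numbers for two parties, with two settings `r`, `t` and
two outcomes `a`, `b` each. -/
abbrev Table222 : Type := Fin 2 → Fin 2 → Fin 2 → Fin 2 → ℝ

/-- A density matrix: positive semidefinite of trace one. -/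
structure IsDensityMatrix {ι : Type*} [Fintype ι] (ρ : Matrix ι ι ℂ) : Prop where
  posSemidef : ρ.PosSemidef
  trace_eq_one : ρ.trace = 1

/-- A measurement (POVM) with outcome set `A`. -/
structure IsPOVM {ι A : Type*} [Fintype ι] [DecidableEq ι] [Fintype A]
    (E : A → Matrix ι ι ℂ) : Prop where
  posSemidef : ∀ a, (E a).PosSemidef
  sum_eq_one : ∑ a, E a = 1

/-- The quantum `(2,2,2)`-behaviours: `p(a, b | r, t) = tr[ρ (E_r^a ⊗ F_t^b)]` for a state `ρ` on
the tensor product of two finite-dimensional Hilbert spaces, two two-outcome measurements `E_r` on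
the first one, and two two-outcome measurements `F_t` on the second one. -/
def quantumBehaviours : Set Table222 :=
  {p | ∃ (m n : ℕ) (ρ : Matrix (Fin m × Fin n) (Fin m × Fin n) ℂ)
      (E : Fin 2 → Fin 2 → Matrix (Fin m) (Fin m) ℂ)
      (F : Fin 2 → Fin 2 → Matrix (Fin n) (Fin n) ℂ),
      IsDensityMatrix ρ ∧ (∀ r, IsPOVM (E r)) ∧ (∀ t, IsPOVM (F t)) ∧
        ∀ a b r t, (p a b r t : ℂ) = (ρ * (E r a ⊗ₖ F t b)).trace}

/-- The `(2,2,2)`-behaviours that arise from a single binary-outcome no-signalling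
`SO(d) × SO(d)`-box that transforms fundamentally locally and is locally unbiased, by restricting
each party to two choices `x 0, x 1` (respectively `y 0, y 1`) of input direction. -/
def boxBehaviours (d : ℕ) : Set Table222 :=
  {p | ∃ P : Fin 2 → Fin 2 → Direction d → Direction d → ℝ,
      IsNoSignallingBox P ∧ TransformsFundamentallyLocally P ∧ LocallyUnbiased P ∧
        ∃ x y : Fin 2 → Direction d, ∀ a b r t, p a b r t = P a b (x r) (y t)}

/-- Statistical mixing by shared randomness: the parties share a random variable `k` with finitely
many values, which has the value `k` with probability `w k`, and use a behaviour `q k` from `S`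
that depends on `k`. -/
def sharedRandomnessMixtures (S : Set Table222) : Set Table222 :=
  {p | ∃ (N : ℕ) (w : Fin N → ℝ) (q : Fin N → Table222),
      (∀ k, 0 ≤ w k) ∧ ∑ k, w k = 1 ∧ (∀ k, q k ∈ S) ∧
        ∀ a b r t, p a b r t = ∑ k, w k * q k a b r t}

end

/-! The two inclusions meet in the following description: both sides consist of mixtures of
behaviours `tr[ρ (Q(± z_r) ⊗ Q(± w_t))]`, where `ρ` is a state of two qubits and
`Q(z) = (1 + re z σ_z + im z σ_x) / 2` is the qubit effect `qubitEffect z` whose Bloch vector `z` is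
a unit vector of a fixed plane.

From boxes to quantum behaviours. Only two directions per party matter, and they lie in a plane. A
box that transforms fundamentally has probabilities that are affine in the rotation, and its Haar
average is the constant term, which is `1 / 2` by unbiasedness; averaging over rotations by diagonal
sign matrices shows that opposite directions have opposite biases
(`apply_add_apply_neg_eq_one`). So the box restricted to the two planes is a bi-affine function `F`
that is nonnegative on pairs of unit vectors, with outcomes flipped by reversing the directions.
Homogenised through `(u, v) ↦ F(u², v²)` it is a nonnegative biquadratic form in two times two
variables, that is, a quadratic form on `ℝ² ⊗ ℝ²` that is nonnegative at the product vectors. As the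
product vectors are the zeros of the determinant, an indefinite quadratic form, the S-lemma
(`QuadraticMap.exists_forall_nonneg_add_mul`) makes the form positive semidefinite by adding a
multiple of the determinant, without changing its values at product vectors. The resulting matrix is
the state of two qubits (`exists_posSemidef_of_biAffine_nonneg`). Mixtures of quantum behaviours are
quantum by taking direct sums.

From quantum behaviours to boxes. Two measurements with two outcomes are dilated to reflections
`U₀`, `U₁`, which are simultaneously compressed to planar qubit observables along the eigenvectors
of the unitary `U₀ U₁` (`exists_kraus_of_reflections`, a form of Jordan's lemma). The outcomes of
the local operations thus obtained are the shared randomness, and conditionally on them the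
behaviour is that of two qubits. Projecting directions in `S^{d-1}` to Bloch vectors in the plane
extends such a behaviour to a box, whose probabilities are affine in each direction, with constant
terms that do not depend on the outcome of the party concerned (`qubitBox`). -/

noncomputable section

/-! ### The homogeneous S-lemma with one equality constraint -/

/-- The two-dimensional case of the S-lemma below: it compares the values of `M` and `K` at a
vector where `K` is positive and at one where `K` is negative. -/
theorem QuadraticMap.mul_neg_add_mul_nonneg_of_nonneg_on_zeros {V : Type*} [AddCommGroup V]
    [Module ℝ V] (M K : QuadraticForm ℝ V) (h : ∀ z, K z = 0 → 0 ≤ M z) {z z' : V}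
    (hz : 0 < K z) (hz' : K z' < 0) : 0 ≤ M z * (-K z') + M z' * K z := by
  have expand : ∀ (N : QuadraticForm ℝ V) (t : ℝ),
      N (z + t • z') = N z + t * QuadraticMap.polar N z z' + t * t * N z' := by
    intro N t
    rw [QuadraticMap.map_add N, QuadraticMap.map_smul, QuadraticMap.polar_smul_right]
    simp only [smul_eq_mul]
    ring
  set k := QuadraticMap.polar K z z'
  set m := QuadraticMap.polar M z z'
  -- The two roots of `t ↦ K (z + t • z')` have opposite signs, as `K z * K z' < 0`.
  have hD : 0 < k * k - 4 * K z' * K z := by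
    nlinarith [mul_pos hz (neg_pos.2 hz'), mul_self_nonneg k]
  set s := Real.sqrt (k * k - 4 * K z' * K z) with hs
  have hss : s * s = k * k - 4 * K z' * K z := Real.mul_self_sqrt hD.le
  have hspos : 0 < s := Real.sqrt_pos.2 hD
  have root : ∀ t, 2 * K z' * t = -k + s ∨ 2 * K z' * t = -k - s →
      0 ≤ M z + t * m + t * t * M z' := by
    intro t ht
    rw [← expand]
    apply h
    rw [expand]
    have h4 : (4 * K z') * (K z + t * k + t * t * K z') = 0 := by
      have : (2 * K z' * t + k) * (2 * K z' * t + k) = s * s := by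
        rcases ht with ht | ht <;> rw [ht] <;> ring
      nlinarith
    rcases mul_eq_zero.1 h4 with h5 | h5
    · linarith
    · exact h5
  have hne : K z' ≠ 0 := hz'.ne
  have h1 := root ((-k + s) / (2 * K z')) (Or.inl (by field_simp))
  have h2 := root ((-k - s) / (2 * K z')) (Or.inr (by field_simp))
  set c := K z' with hc
  -- The combination of the two inequalities in which the polar form of `M` cancels.
  have ha : 0 < s + k := by
    by_contra hcon
    nlinarith [mul_pos hz (neg_pos.2 hz')]
  have hb : 0 < s - k := by
    by_contra hcon
    nlinarith [mul_pos hz (neg_pos.2 hz')]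
  have e1 : 0 ≤ 4 * c ^ 2 * M z + 2 * c * (-k + s) * m + (-k + s) ^ 2 * M z' := by
    have := mul_nonneg (by positivity : (0:ℝ) ≤ 4 * c ^ 2) h1
    have e : 4 * c ^ 2 * (M z + (-k + s) / (2 * c) * m
        + (-k + s) / (2 * c) * ((-k + s) / (2 * c)) * M z')
        = 4 * c ^ 2 * M z + 2 * c * (-k + s) * m + (-k + s) ^ 2 * M z' := by
      field_simp
      ring
    linarith
  have e2 : 0 ≤ 4 * c ^ 2 * M z + 2 * c * (-k - s) * m + (-k - s) ^ 2 * M z' := by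
    have := mul_nonneg (by positivity : (0:ℝ) ≤ 4 * c ^ 2) h2
    have e : 4 * c ^ 2 * (M z + (-k - s) / (2 * c) * m
        + (-k - s) / (2 * c) * ((-k - s) / (2 * c)) * M z')
        = 4 * c ^ 2 * M z + 2 * c * (-k - s) * m + (-k - s) ^ 2 * M z' := by
      field_simp
      ring
    linarith
  have e3 : 0 ≤ (s + k) * (4 * c ^ 2 * M z + 2 * c * (-k + s) * m + (-k + s) ^ 2 * M z')
      + (s - k) * (4 * c ^ 2 * M z + 2 * c * (-k - s) * m + (-k - s) ^ 2 * M z') :=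
    add_nonneg (mul_nonneg ha.le e1) (mul_nonneg hb.le e2)
  have e4 : (s + k) * (4 * c ^ 2 * M z + 2 * c * (-k + s) * m + (-k + s) ^ 2 * M z')
      + (s - k) * (4 * c ^ 2 * M z + 2 * c * (-k - s) * m + (-k - s) ^ 2 * M z')
      = 2 * s * (-4 * c) * (M z * (-c) + M z' * K z) := by
    have : (s + k) * (-k + s) ^ 2 * M z' + (s - k) * (-k - s) ^ 2 * M z'
        = 2 * s * (s * s - k * k) * M z' := by ring
    rw [hss] at this
    linear_combination this
  rw [e4] at e3
  exact nonneg_of_mul_nonneg_right e3 (by nlinarith)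

/-- The homogeneous S-lemma with an equality constraint: if the quadratic form `M` is nonnegative
on the zeros of an indefinite quadratic form `K`, then some form `M + w K` is nonnegative. -/
theorem QuadraticMap.exists_forall_nonneg_add_mul {V : Type*} [AddCommGroup V] [Module ℝ V]
    (M K : QuadraticForm ℝ V) (hpos : ∃ z, 0 < K z) (hneg : ∃ z, K z < 0)
    (h : ∀ z, K z = 0 → 0 ≤ M z) : ∃ w : ℝ, ∀ z, 0 ≤ M z + w * K z := by
  have key : ∀ z z', 0 < K z → K z' < 0 → -M z / K z ≤ -M z' / K z' := by
    intro z z' hz hz'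
    have := QuadraticMap.mul_neg_add_mul_nonneg_of_nonneg_on_zeros M K h hz hz'
    rw [neg_div, neg_div, neg_le_neg_iff, div_le_iff_of_neg hz', div_mul_eq_mul_div,
      div_le_iff₀ hz]
    linarith
  obtain ⟨z₀, hz₀⟩ := hpos
  obtain ⟨z₁, hz₁⟩ := hneg
  have hbdd : BddAbove ((fun z => -M z / K z) '' {z | 0 < K z}) :=
    ⟨-M z₁ / K z₁, by rintro _ ⟨z, hz, rfl⟩; exact key z z₁ hz hz₁⟩
  refine ⟨sSup ((fun z => -M z / K z) '' {z | 0 < K z}), fun z => ?_⟩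
  rcases lt_trichotomy (K z) 0 with hz | hz | hz
  · have := csSup_le (Set.Nonempty.image _ ⟨z₀, hz₀⟩)
      (by rintro _ ⟨z', hz', rfl⟩; exact key z' z hz' hz :
        ∀ b ∈ (fun z => -M z / K z) '' {z | 0 < K z}, b ≤ -M z / K z)
    rw [le_div_iff_of_neg hz] at this
    linarith
  · simpa [hz] using h z hz
  · have := le_csSup hbdd ⟨z, hz, rfl⟩
    simp only at this
    rw [div_le_iff₀ hz] at this
    linarith

/-! ### Nonnegative bi-affine functions on two discs come from two-qubit states -/

/-- The effect `(1 + re z σ_z + im z σ_x) / 2` of a qubit; for `‖z‖ ≤ 1` it is positive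
semidefinite. The Bloch vectors of these effects lie in the plane of the real matrices. -/
def qubitEffect (z : ℂ) : Matrix (Fin 2) (Fin 2) ℂ :=
  !![(1 + (z.re : ℂ)) / 2, (z.im : ℂ) / 2; (z.im : ℂ) / 2, (1 - (z.re : ℂ)) / 2]

/-- The coordinates `(1, re z, im z)`, in which affine functions of `z` are linear. -/
def affineCoord (z : ℂ) : Fin 3 → ℝ := ![1, z.re, z.im]

/-- The value at `(z, w)` of the bi-affine function on `ℂ × ℂ` with coefficient matrix `M`. -/
def biAffine (M : Fin 3 → Fin 3 → ℝ) (z w : ℂ) : ℝ :=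
  ∑ i, ∑ j, M i j * affineCoord z i * affineCoord w j

/-- The basis `1, σ_z, σ_x` of the real symmetric `2 × 2` matrices. -/
def realPauli : Fin 3 → Matrix (Fin 2) (Fin 2) ℝ :=
  ![1, !![1, 0; 0, -1], !![0, 1; 1, 0]]

/-- The symmetric matrix `∑ M i j (τ_i ⊗ τ_j)`, whose quadratic form at product vectors is the
bi-affine function with coefficients `M`, homogenised. -/
def pauliSum (M : Fin 3 → Fin 3 → ℝ) : Matrix (Fin 2 × Fin 2) (Fin 2 × Fin 2) ℝ :=
  ∑ i, ∑ j, M i j • (realPauli i ⊗ₖ realPauli j)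

/-- The symmetric matrix `ε ⊗ ε` with `ε` antisymmetric; its quadratic form is twice the
determinant on `ℝ² ⊗ ℝ²`, so it vanishes exactly at the product vectors. -/
def detForm : Matrix (Fin 2 × Fin 2) (Fin 2 × Fin 2) ℝ :=
  !![0, 1; -1, 0] ⊗ₖ !![0, 1; -1, 0]

theorem isSymm_pauliSum (M : Fin 3 → Fin 3 → ℝ) : (pauliSum M).IsSymm := by
  have h : ∀ i, (realPauli i)ᵀ = realPauli i := by
    intro i
    ext a b
    fin_cases i <;> fin_cases a <;> fin_cases b <;> simp [realPauli]
  rw [Matrix.IsSymm, pauliSum, Matrix.transpose_sum]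
  refine Finset.sum_congr rfl fun i _ => ?_
  rw [Matrix.transpose_sum]
  refine Finset.sum_congr rfl fun j _ => ?_
  rw [Matrix.transpose_smul, ← Matrix.kroneckerMap_transpose, h, h]

theorem isSymm_detForm : detForm.IsSymm := by
  ext ⟨a, b⟩ ⟨c, e⟩
  fin_cases a <;> fin_cases b <;> fin_cases c <;> fin_cases e <;> simp [detForm]

theorem dotProduct_detForm_mulVec (z : Fin 2 × Fin 2 → ℝ) :
    z ⬝ᵥ (detForm *ᵥ z) = 2 * (z (0, 0) * z (1, 1) - z (0, 1) * z (1, 0)) := by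
  simp [detForm, dotProduct, Matrix.mulVec, Fintype.sum_prod_type, Fin.sum_univ_two]
  ring

theorem exists_eq_mul_of_det_eq_zero (z : Fin 2 × Fin 2 → ℝ)
    (h : z (0, 0) * z (1, 1) - z (0, 1) * z (1, 0) = 0) :
    ∃ α β : ℂ, z = fun p => ![α.re, α.im] p.1 * ![β.re, β.im] p.2 := by
  by_cases h0 : z (0, 0) = 0
  · by_cases h1 : z (0, 1) = 0
    · refine ⟨⟨0, 1⟩, ⟨z (1, 0), z (1, 1)⟩, ?_⟩
      ext ⟨i, j⟩
      fin_cases i <;> fin_cases j <;> simp [h0, h1]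
    · have h2 : z (1, 0) = 0 := by simpa [h0, h1] using h
      refine ⟨⟨1, z (1, 1) / z (0, 1)⟩, ⟨0, z (0, 1)⟩, ?_⟩
      ext ⟨i, j⟩
      fin_cases i <;> fin_cases j <;> simp [h0, h1, h2]
  · refine ⟨⟨1, z (1, 0) / z (0, 0)⟩, ⟨z (0, 0), z (0, 1)⟩, ?_⟩
    ext ⟨i, j⟩
    fin_cases i <;> fin_cases j <;> simp [h0]
    field_simp
    linarith

/-- A product vector `α ⊗ β` has, in the form of `pauliSum M`, the value `‖α‖² ‖β‖² f(z, w)`, where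
`f` is the bi-affine function of `M` and `z`, `w` are the Bloch vectors `(α / ‖α‖)²`,
`(β / ‖β‖)²`. -/
theorem dotProduct_pauliSum_mulVec_product (M : Fin 3 → Fin 3 → ℝ) (α β : ℂ) (hα : α ≠ 0)
    (hβ : β ≠ 0) :
    (fun p : Fin 2 × Fin 2 => ![α.re, α.im] p.1 * ![β.re, β.im] p.2) ⬝ᵥ
      (pauliSum M *ᵥ fun p => ![α.re, α.im] p.1 * ![β.re, β.im] p.2) =
      Complex.normSq α * Complex.normSq β *
        biAffine M ((Complex.normSq α)⁻¹ • α ^ 2) ((Complex.normSq β)⁻¹ • β ^ 2) := by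
  have h : ∀ α : ℂ, α ≠ 0 → ∀ i,
      ![α.re, α.im] ⬝ᵥ (realPauli i *ᵥ ![α.re, α.im]) =
        Complex.normSq α * affineCoord ((Complex.normSq α)⁻¹ • α ^ 2) i := by
    intro α hα i
    have : Complex.normSq α ≠ 0 := by simpa using hα
    fin_cases i
    · simp [realPauli, affineCoord, Complex.normSq_apply]
    · simp [realPauli, affineCoord, this, sq, Matrix.vecHead, Matrix.vecTail]
      ring
    · simp [realPauli, affineCoord, this, sq, Matrix.vecHead, Matrix.vecTail]
  have h2 : ∀ (A B : Matrix (Fin 2) (Fin 2) ℝ) (a b : Fin 2 → ℝ),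
      (fun p : Fin 2 × Fin 2 => a p.1 * b p.2) ⬝ᵥ ((A ⊗ₖ B) *ᵥ fun p => a p.1 * b p.2) =
        (a ⬝ᵥ (A *ᵥ a)) * (b ⬝ᵥ (B *ᵥ b)) := by
    intro A B a b
    simp [dotProduct, Matrix.mulVec, Fintype.sum_prod_type, Fin.sum_univ_two]
    ring
  rw [pauliSum, Matrix.sum_mulVec, dotProduct_sum, biAffine, Finset.mul_sum]
  refine Finset.sum_congr rfl fun i _ => ?_
  rw [Matrix.sum_mulVec, dotProduct_sum, Finset.mul_sum]
  refine Finset.sum_congr rfl fun j _ => ?_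
  rw [Matrix.smul_mulVec, dotProduct_smul, h2, h α hα, h β hβ, smul_eq_mul]
  ring

theorem norm_inv_normSq_smul_sq {α : ℂ} (hα : α ≠ 0) : ‖(Complex.normSq α)⁻¹ • α ^ 2‖ = 1 := by
  have : ‖α‖ ≠ 0 := by simpa using hα
  rw [norm_smul, norm_pow, Complex.normSq_eq_norm_sq, norm_inv, norm_pow, norm_norm]
  field_simp

theorem Matrix.PosSemidef.map_ofReal {ι : Type*} [Fintype ι] {A : Matrix ι ι ℝ}
    (hA : A.PosSemidef) : (A.map (Complex.ofReal)).PosSemidef := by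
  obtain ⟨B, rfl⟩ : ∃ B : Matrix ι ι ℝ, A = Bᴴ * B := by
    classical
    open scoped MatrixOrder Matrix.Norms.L2Operator in
    exact CStarAlgebra.nonneg_iff_eq_star_mul_self.mp hA.nonneg
  have : (Bᴴ * B).map Complex.ofReal =
      (B.map Complex.ofReal)ᴴ * (B.map Complex.ofReal) := by
    ext i j
    simp [Matrix.mul_apply]
  rw [this]
  exact Matrix.posSemidef_conjTranspose_mul_self _

/-- A bi-affine function that is nonnegative on pairs of unit vectors is the table of a positive
operator on two qubits. Its homogenisation is a biquadratic form in two times two variables; the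
S-lemma corrects the matrix of that form, by a multiple of `detForm`, to a positive one. -/
theorem exists_posSemidef_of_biAffine_nonneg (M : Fin 3 → Fin 3 → ℝ)
    (hM : ∀ z w : ℂ, ‖z‖ = 1 → ‖w‖ = 1 → 0 ≤ biAffine M z w) :
    ∃ ρ : Matrix (Fin 2 × Fin 2) (Fin 2 × Fin 2) ℂ, ρ.PosSemidef ∧ ρ.trace = (4 * M 0 0 : ℝ) ∧
      ∀ z w, (biAffine M z w : ℂ) = (ρ * (qubitEffect z ⊗ₖ qubitEffect w)).trace := by
  have hq : ∀ (A : Matrix (Fin 2 × Fin 2) (Fin 2 × Fin 2) ℝ) z,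
      A.toQuadraticForm' z = z ⬝ᵥ (A *ᵥ z) := by
    intro A z
    simp [Matrix.toQuadraticForm', Matrix.toLinearMap₂'_apply']
  obtain ⟨w, hw⟩ := QuadraticMap.exists_forall_nonneg_add_mul
    (pauliSum M).toQuadraticForm' detForm.toQuadraticForm'
    ⟨fun p => if p.1 = p.2 then 1 else 0, by simp [hq, dotProduct_detForm_mulVec]⟩
    ⟨fun p => if p.1 = p.2 then 0 else 1, by simp [hq, dotProduct_detForm_mulVec]⟩
    (by
      intro z hz
      rw [hq, dotProduct_detForm_mulVec] at hz
      obtain ⟨α, β, rfl⟩ := exists_eq_mul_of_det_eq_zero z (by linarith)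
      rw [hq]
      by_cases hα : α = 0
      · subst hα
        refine le_of_eq ?_
        rw [dotProduct, Fintype.sum_prod_type]
        simp
      by_cases hβ : β = 0
      · subst hβ
        refine le_of_eq ?_
        rw [dotProduct, Fintype.sum_prod_type]
        simp
      rw [dotProduct_pauliSum_mulVec_product M α β hα hβ]
      exact mul_nonneg (mul_nonneg (Complex.normSq_nonneg _) (Complex.normSq_nonneg _))
        (hM _ _ (norm_inv_normSq_smul_sq hα) (norm_inv_normSq_smul_sq hβ)))
  have hpsd : (pauliSum M + w • detForm).PosSemidef := by
    refine Matrix.PosSemidef.of_dotProduct_mulVec_nonneg ?_ fun z => ?_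
    · rw [Matrix.isHermitian_iff_isSymm]
      exact (isSymm_pauliSum M).add (isSymm_detForm.smul w)
    · have := hw z
      rw [hq, hq] at this
      simpa [Matrix.add_mulVec, Matrix.smul_mulVec, dotProduct_add] using this
  refine ⟨_, hpsd.map_ofReal, ?_, fun z w => ?_⟩
  · simp [Matrix.trace, Fintype.sum_prod_type, Fin.sum_univ_two, Fin.sum_univ_three, pauliSum,
      detForm, realPauli, Matrix.add_apply]
    ring
  · simp [Matrix.trace, Fintype.sum_prod_type, Fin.sum_univ_two, Fin.sum_univ_three, pauliSum,
      detForm, realPauli, Matrix.mul_apply, qubitEffect, biAffine, affineCoord,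
      Matrix.add_apply]
    ring

/-! ### Qubit measurements -/

theorem qubitEffect_add_neg (z : ℂ) : qubitEffect z + qubitEffect (-z) = 1 := by
  ext i j
  fin_cases i <;> fin_cases j <;> simp [qubitEffect] <;> ring

theorem posSemidef_qubitEffect_of_norm_eq_one {z : ℂ} (hz : ‖z‖ = 1) :
    (qubitEffect z).PosSemidef := by
  have h1 : z.re * z.re + z.im * z.im = 1 := by
    rw [← Complex.normSq_apply, Complex.normSq_eq_norm_sq, hz, one_pow]
  have h2 : (z.re : ℂ) * z.re + (z.im : ℂ) * z.im = 1 := by exact_mod_cast h1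
  have h : qubitEffect z = (qubitEffect z)ᴴ * qubitEffect z := by
    ext i j
    fin_cases i <;> fin_cases j <;>
      simp [qubitEffect, Matrix.mul_apply, Fin.sum_univ_two, map_ofNat] <;>
      first | ring1 | linear_combination (-1 / 4) * h2
  rw [h]
  exact Matrix.posSemidef_conjTranspose_mul_self _

theorem posSemidef_qubitEffect {z : ℂ} (hz : ‖z‖ ≤ 1) : (qubitEffect z).PosSemidef := by
  -- `z` is a convex combination of the unit vectors `u` and `-u`.
  set u := Complex.exp (Complex.arg z * Complex.I)
  have hu : ‖u‖ = 1 := Complex.norm_exp_ofReal_mul_I _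
  have hzu : z = (‖z‖ : ℂ) * u := (Complex.norm_mul_exp_arg_mul_I z).symm
  have h : qubitEffect z =
      ((1 + ‖z‖) / 2) • qubitEffect u + ((1 - ‖z‖) / 2) • qubitEffect (-u) := by
    have hre : z.re = ‖z‖ * u.re := by
      conv_lhs => rw [hzu, Complex.re_ofReal_mul]
    have him : z.im = ‖z‖ * u.im := by
      conv_lhs => rw [hzu, Complex.im_ofReal_mul]
    ext i j
    fin_cases i <;> fin_cases j <;> simp [qubitEffect, hre, him] <;> ring
  rw [h]
  exact ((posSemidef_qubitEffect_of_norm_eq_one hu).smul (by linarith [norm_nonneg z])).add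
    ((posSemidef_qubitEffect_of_norm_eq_one (by rwa [norm_neg])).smul (by linarith))

/-- The sign `±1` that stands for a binary outcome. -/
def outcomeSign (a : Fin 2) : ℝ := ![1, -1] a

@[simp] theorem outcomeSign_zero : outcomeSign 0 = 1 := rfl

@[simp] theorem outcomeSign_one : outcomeSign 1 = -1 := rfl

theorem isPOVM_qubitEffect {z : ℂ} (hz : ‖z‖ ≤ 1) :
    IsPOVM fun a => qubitEffect (outcomeSign a • z) where
  posSemidef a := by
    apply posSemidef_qubitEffect
    fin_cases a <;> simpa
  sum_eq_one := by simpa using qubitEffect_add_neg z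

/-! ### Rotations -/

theorem rotate_mul {d : ℕ} (R S : Rotation d) (x : Direction d) :
    rotate (R * S) x = rotate R (rotate S x) := by
  ext i
  simp [rotate, Matrix.mulVec_mulVec]

theorem rotate_neg {d : ℕ} (R : Rotation d) (x : Direction d) : rotate R (-x) = -rotate R x := by
  ext i
  simp [rotate, Matrix.mulVec_neg]

/-- The families of signs with product one. -/
def evenSigns (d : ℕ) : Subgroup (Fin d → ℤˣ) where
  carrier := {ε | ∏ i, ε i = 1}
  mul_mem' {ε δ} hε hδ := by
    simp only [Set.mem_ofPred_eq] at hε hδ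
    simp [Finset.prod_mul_distrib, hε, hδ]
  one_mem' := by simp
  inv_mem' {ε} hε := by simpa using hε

theorem exists_evenSigns_apply_eq_neg_one {d : ℕ} (hd : 2 ≤ d) (i : Fin d) :
    ∃ δ : evenSigns d, δ.1 i = -1 := by
  have : Nontrivial (Fin d) := Fin.nontrivial_iff_two_le.2 hd
  obtain ⟨j, hj⟩ := exists_ne i
  refine ⟨⟨fun k => (if k = i then -1 else 1) * (if k = j then -1 else 1), ?_⟩, ?_⟩
  · change ∏ k, (_ : ℤˣ) = 1
    rw [Finset.prod_mul_distrib]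
    simp
  · simp [hj.symm]

theorem sum_evenSigns_apply {d : ℕ} (hd : 2 ≤ d) [Fintype (evenSigns d)] (i : Fin d) :
    ∑ ε : evenSigns d, (((ε.1 i : ℤˣ) : ℤ) : ℝ) = 0 := by
  obtain ⟨δ, hδ⟩ := exists_evenSigns_apply_eq_neg_one hd i
  have h := Equiv.sum_comp (Equiv.mulLeft δ) fun ε : evenSigns d => (((ε.1 i : ℤˣ) : ℤ) : ℝ)
  simp only [Equiv.coe_mulLeft, Subgroup.coe_mul, Pi.mul_apply, hδ, neg_mul, one_mul,
    Units.val_neg, Int.cast_neg, Finset.sum_neg_distrib] at h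
  linarith

/-- The rotation by a diagonal matrix of signs with product one. -/
def signRotation {d : ℕ} (ε : evenSigns d) : Rotation d :=
  ⟨Matrix.diagonal fun i => ((ε.1 i : ℤˣ) : ℤ), by
    rw [Matrix.mem_specialOrthogonalGroup_iff, Matrix.mem_orthogonalGroup_iff]
    constructor
    · rw [Matrix.diagonal_transpose, Matrix.diagonal_mul_diagonal, ← Matrix.diagonal_one]
      congr 1
      ext i
      rcases Int.units_eq_one_or (ε.1 i) with h | h <;> simp [h]
    · have := congrArg (fun u : ℤˣ => ((u : ℤ) : ℝ)) ε.2
      simpa [Matrix.det_diagonal] using this⟩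

/-- Left multiplication by signs with `δ i = -1` changes the sign of the entry `R i j`. -/
theorem integral_rotation_apply {d : ℕ} (hd : 2 ≤ d) (i j : Fin d) :
    ∫ R : Rotation d, R.1 i j ∂(rotationHaar d) = 0 := by
  obtain ⟨δ, hδ⟩ := exists_evenSigns_apply_eq_neg_one hd i
  have : (rotationHaar d).IsMulLeftInvariant := by
    unfold rotationHaar
    infer_instance
  have h := integral_mul_left_eq_self (μ := rotationHaar d) (fun R : Rotation d => R.1 i j)
    (signRotation δ)
  simp only [signRotation, Submonoid.coe_mul, Matrix.diagonal_mul, hδ] at h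
  simp only [Units.val_neg, Units.val_one, Int.cast_neg, Int.cast_one, neg_mul, one_mul,
    integral_neg] at h
  linarith

instance isProbabilityMeasure_rotationHaar (d : ℕ) : IsProbabilityMeasure (rotationHaar d) :=
  ⟨by simpa [rotationHaar] using Measure.haarMeasure_self
        (K₀ := (⊤ : TopologicalSpace.PositiveCompacts (Rotation d)))⟩

theorem integrable_rotation_apply {d : ℕ} (i j : Fin d) :
    Integrable (fun R : Rotation d => R.1 i j) (rotationHaar d) := by
  have hc : Continuous fun R : Rotation d => R.1 i j := continuous_subtype_val.matrix_elem i j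
  exact (hc.integrable_of_hasCompactSupport (HasCompactSupport.of_compactSpace _))

theorem integrable_const_add_sum_rotation_mul {d : ℕ} (c₀ : ℝ) (c : Fin d → Fin d → ℝ) :
    Integrable (fun R : Rotation d => c₀ + ∑ i, ∑ j, R.1 i j * c i j) (rotationHaar d) :=
  (integrable_const _).add (integrable_finsetSum _ fun i _ => integrable_finsetSum _ fun j _ =>
    (integrable_rotation_apply i j).mul_const _)

theorem integral_const_add_sum_rotation_mul {d : ℕ} (hd : 2 ≤ d) (c₀ : ℝ)
    (c : Fin d → Fin d → ℝ) :
    ∫ R : Rotation d, (c₀ + ∑ i, ∑ j, R.1 i j * c i j) ∂(rotationHaar d) = c₀ := by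
  have hint : ∀ i j, Integrable (fun R : Rotation d => R.1 i j * c i j) (rotationHaar d) :=
    fun i j => (integrable_rotation_apply i j).mul_const _
  rw [integral_add (integrable_const _) (integrable_finsetSum _ fun i _ =>
    integrable_finsetSum _ fun j _ => hint i j), integral_finsetSum _ fun i _ =>
    integrable_finsetSum _ fun j _ => hint i j]
  simp [integral_finsetSum _ fun j _ => hint _ j, integral_mul_const, integral_rotation_apply hd]

/-! ### Directions in a coordinate plane -/

/-- The direction with coordinates `re z`, `im z` in the coordinate plane singled out by `e`. -/
def planarDirection {d n : ℕ} (e : Fin 2 ⊕ Fin n ≃ Fin d) (z : Circle) : Direction d :=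
  ⟨WithLp.toLp 2 (Sum.elim ![(z : ℂ).re, (z : ℂ).im] 0 ∘ e.symm), by
    have h := Circle.normSq_coe z
    rw [Complex.normSq_apply] at h
    rw [mem_sphere_zero_iff_norm, EuclideanSpace.norm_eq, Real.sqrt_eq_one, ← e.sum_comp]
    simpa [Fintype.sum_sum_type, Fin.sum_univ_two, ← sq] using h⟩

theorem planarDirection_neg {d n : ℕ} (e : Fin 2 ⊕ Fin n ≃ Fin d) (z : Circle) :
    planarDirection e (-z) = -planarDirection e z := by
  ext i
  obtain ⟨i, rfl⟩ := e.surjective i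
  rcases i with i | i
  · fin_cases i <;> simp [planarDirection]
  · simp [planarDirection]

/-- The rotation by the angle of `z` in the coordinate plane singled out by `e`. -/
def planarRotation {d n : ℕ} (e : Fin 2 ⊕ Fin n ≃ Fin d) (z : Circle) : Rotation d :=
  ⟨(Matrix.fromBlocks !![(z : ℂ).re, -(z : ℂ).im; (z : ℂ).im, (z : ℂ).re] 0 0 1).submatrix
      e.symm e.symm, by
    have h := Circle.normSq_coe z
    rw [Complex.normSq_apply] at h
    rw [Matrix.mem_specialOrthogonalGroup_iff, Matrix.mem_orthogonalGroup_iff]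
    constructor
    · rw [Matrix.transpose_submatrix, Matrix.submatrix_mul_equiv, Matrix.fromBlocks_transpose,
        Matrix.fromBlocks_multiply]
      have : !![(z : ℂ).re, -(z : ℂ).im; (z : ℂ).im, (z : ℂ).re] *
          !![(z : ℂ).re, -(z : ℂ).im; (z : ℂ).im, (z : ℂ).re]ᵀ = 1 := by
        ext i j
        fin_cases i <;> fin_cases j <;> simp [Matrix.mul_apply, Fin.sum_univ_two] <;> linarith
      simp [this]
    · rw [Matrix.det_submatrix_equiv_self, Matrix.det_fromBlocks_zero₁₂]
      simpa using h⟩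

theorem rotate_planarRotation {d n : ℕ} (e : Fin 2 ⊕ Fin n ≃ Fin d) (z : Circle) :
    rotate (planarRotation e z) (planarDirection e 1) = planarDirection e z := by
  ext i
  obtain ⟨i, rfl⟩ := e.surjective i
  simp only [rotate, planarRotation, planarDirection, Matrix.mulVec, dotProduct]
  rw [← e.sum_comp]
  rcases i with i | i
  · fin_cases i <;> simp [Fintype.sum_sum_type, Fin.sum_univ_two]
  · simp [Fintype.sum_sum_type]

theorem rotate_signRotation_planarDirection_one {d n : ℕ} (e : Fin 2 ⊕ Fin n ≃ Fin d)
    (ε : evenSigns d) :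
    rotate (signRotation ε) (planarDirection e 1) =
      if ε.1 (e (Sum.inl 0)) = 1 then planarDirection e 1 else -planarDirection e 1 := by
  ext i
  obtain ⟨i, rfl⟩ := e.surjective i
  rcases i with i | i
  · fin_cases i
    · rcases Int.units_eq_one_or (ε.1 (e (Sum.inl 0))) with h | h <;>
        simp [h, rotate, signRotation, planarDirection, Matrix.mulVec_diagonal]
    · split_ifs <;> simp [rotate, signRotation, planarDirection, Matrix.mulVec_diagonal]
  · split_ifs <;> simp [rotate, signRotation, planarDirection, Matrix.mulVec_diagonal]

/-- Any two directions lie in the image of a coordinate plane under a rotation. -/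
theorem exists_rotate_planarDirection_eq {d n : ℕ} (e : Fin 2 ⊕ Fin n ≃ Fin d)
    (x : Fin 2 → Direction d) :
    ∃ (O : Rotation d) (z : Fin 2 → Circle), ∀ r, x r = rotate O (planarDirection e (z r)) := by
  set i₀ := e (Sum.inl 0) with hi₀
  set i₁ := e (Sum.inl 1) with hi₁
  have h01 : i₀ ≠ i₁ := by simp [hi₀, hi₁]
  have hcard : Module.finrank ℝ (EuclideanSpace ℝ (Fin d)) = Fintype.card (Fin d) := by simp
  have hx : ∀ r, ‖(x r).1‖ = 1 := fun r => mem_sphere_zero_iff_norm.1 (x r).2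
  -- a unit vector orthogonal to `x 0` such that `x 1` lies in the plane of the two
  obtain ⟨v, hv, hxv, s, hs⟩ : ∃ v : EuclideanSpace ℝ (Fin d), ‖v‖ = 1 ∧
      inner ℝ (x 0).1 v = 0 ∧ ∃ s : ℝ,
        (x 1).1 = inner ℝ (x 0).1 (x 1).1 • (x 0).1 + s • v := by
    set w := (x 1).1 - inner ℝ (x 0).1 (x 1).1 • (x 0).1 with hw
    by_cases hw0 : w = 0
    · obtain ⟨b, hb⟩ := Orthonormal.exists_orthonormalBasis_extension_of_card_eq (𝕜 := ℝ) hcard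
        (v := fun _ => (x 0).1) (s := {i₀})
        ⟨fun _ => hx 0, fun i j hij => absurd (Subsingleton.elim i j) hij⟩
      refine ⟨b i₁, b.orthonormal.1 i₁, ?_, 0, ?_⟩
      · rw [← hb i₀ rfl]
        exact b.orthonormal.2 h01
      · rw [zero_smul, add_zero]
        exact sub_eq_zero.1 hw0
    · have hn : ‖w‖ ≠ 0 := norm_ne_zero_iff.2 hw0
      refine ⟨‖w‖⁻¹ • w, ?_, ?_, ‖w‖, ?_⟩
      · rw [norm_smul, norm_inv, norm_norm, inv_mul_cancel₀ hn]
      · rw [inner_smul_right, hw, inner_sub_right, inner_smul_right, real_inner_self_eq_norm_sq,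
          hx 0]
        simp
      · rw [smul_smul, mul_inv_cancel₀ hn, one_smul, hw]
        abel
  set c := inner ℝ (x 0).1 (x 1).1 with hc
  have hcs : c * c + s * s = 1 := by
    have h := hx 1
    have h2 : ‖(x 1).1‖ ^ 2 = c * c + s * s := by
      rw [hs, norm_add_sq_real, inner_smul_left, inner_smul_right, hxv, norm_smul, norm_smul, hx 0,
        hv]
      simp [sq]
    rw [h] at h2
    linarith
  obtain ⟨b, hb⟩ := Orthonormal.exists_orthonormalBasis_extension_of_card_eq (𝕜 := ℝ) hcard
    (v := fun i => if i = i₀ then (x 0).1 else v) (s := {i₀, i₁}) (by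
      constructor
      · rintro ⟨i, rfl | rfl⟩
        · simp [Set.domRestrict, hx 0]
        · simp [Set.domRestrict, h01.symm, hv]
      · rintro ⟨i, rfl | rfl⟩ ⟨j, rfl | rfl⟩ hij
        · exact absurd rfl hij
        · simpa [Set.domRestrict, h01.symm] using hxv
        · simpa [Set.domRestrict, h01.symm, real_inner_comm] using hxv
        · exact absurd rfl hij)
  have hb0 : b i₀ = (x 0).1 := by simpa using hb i₀ (by simp)
  have hb1 : b i₁ = v := by simpa [h01.symm] using hb i₁ (by simp)
  -- a suitable orientation is obtained by changing the sign of the second basis vector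
  obtain ⟨σ, hσ, O, hO0, hO1⟩ : ∃ σ : ℝ, σ * σ = 1 ∧ ∃ O : Rotation d,
      (∀ i, O.1 i i₀ = (x 0).1 i) ∧ ∀ i, O.1 i i₁ = σ * v i := by
    set B : Matrix (Fin d) (Fin d) ℝ :=
      (EuclideanSpace.basisFun (Fin d) ℝ).toBasis.toMatrix b with hB
    have hBo : B ∈ Matrix.orthogonalGroup (Fin d) ℝ :=
      OrthonormalBasis.toMatrix_orthonormalBasis_mem_orthogonal _ _
    have hBe : ∀ i j, B i j = b j i := fun i j => by simp [hB, Module.Basis.toMatrix_apply]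
    have hdet : B.det * B.det = 1 := by
      have := congrArg Matrix.det ((Matrix.mem_orthogonalGroup_iff (Fin d) ℝ).1 hBo)
      simpa using this
    set D : Matrix (Fin d) (Fin d) ℝ :=
      Matrix.diagonal fun i => if i = i₁ then B.det else 1 with hD
    refine ⟨B.det, hdet, ⟨B * D, ?_⟩, fun i => ?_, fun i => ?_⟩
    · rw [Matrix.mem_specialOrthogonalGroup_iff]
      refine ⟨Submonoid.mul_mem _ hBo ?_, ?_⟩
      · rw [Matrix.mem_orthogonalGroup_iff, hD, Matrix.diagonal_transpose,
          Matrix.diagonal_mul_diagonal, ← Matrix.diagonal_one]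
        congr 1
        ext i
        split_ifs <;> simp [hdet]
      · rw [Matrix.det_mul, hD, Matrix.det_diagonal]
        simpa using hdet
    · simp [hD, Matrix.mul_diagonal, hBe, h01, hb0]
    · simp [hD, Matrix.mul_diagonal, hBe, hb1, mul_comm]
  have hrot : ∀ (z : Circle) (i : Fin d), (rotate O (planarDirection e z)).1 i =
      (z : ℂ).re * (x 0).1 i + (z : ℂ).im * (σ * v i) := by
    intro z i
    simp only [rotate, planarDirection, Matrix.mulVec, dotProduct]
    rw [← e.sum_comp]
    simp [Fintype.sum_sum_type, Fin.sum_univ_two, ← hi₀, ← hi₁, hO0, hO1]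
    ring
  have hz : ‖(⟨c, σ * s⟩ : ℂ)‖ = 1 := by
    rw [Complex.norm_def, Real.sqrt_eq_one, Complex.normSq_apply]
    linear_combination hcs + s * s * hσ
  refine ⟨O, ![1, ⟨⟨c, σ * s⟩, mem_sphere_zero_iff_norm.2 hz⟩], fun r => ?_⟩
  ext i
  rw [hrot]
  fin_cases r
  · simp
  · have := congrArg (fun y : EuclideanSpace ℝ (Fin d) => y i) hs
    simp only [PiLp.add_apply, PiLp.smul_apply, smul_eq_mul] at this
    change (x 1).1 i = c * (x 0).1 i + σ * s * (σ * v i)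
    linear_combination this - s * v i * hσ

/-! ### Boxes that transform fundamentally and are unbiased, on a plane of directions -/

section Planar

variable {d n : ℕ} {Q : Fin 2 → Direction d → ℝ}

/-- The constant term of the probability as a function of the rotation is its Haar average, hence
`1 / 2` for an unbiased box with two outcomes. -/
theorem exists_apply_rotate_eq_half_add (hd : 2 ≤ d) (hT : TransformsFundamentally Q)
    (hU : Unbiased Q) (hsum : ∀ x, ∑ a, Q a x = 1) (x₀ : Direction d) (a : Fin 2) :
    ∃ c : Fin d → Fin d → ℝ, ∀ R : Rotation d,
      Q a (rotate R x₀) = 1 / 2 + ∑ i, ∑ j, R.1 i j * c i j := by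
  obtain ⟨c₀, c, hc⟩ := hT x₀
  have hc' : ∀ a (R : Rotation d), Q a (rotate R x₀) = c₀ a + ∑ i, ∑ j, R.1 i j * c a i j :=
    fun a R => hc _ R rfl a
  have hint : ∀ a, ∫ R, Q a (rotate R x₀) ∂(rotationHaar d) = c₀ a := by
    intro a
    simp_rw [hc' a]
    exact integral_const_add_sum_rotation_mul hd _ _
  have h01 : c₀ 0 = c₀ 1 := by rw [← hint, ← hint, (hU x₀).2 0 1]
  have h1 : c₀ 0 + c₀ 1 = 1 := by
    rw [← hint, ← hint, ← integral_add ((hU x₀).1 0) ((hU x₀).1 1)]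
    have : ∀ R : Rotation d, Q 0 (rotate R x₀) + Q 1 (rotate R x₀) = 1 := fun R => by
      rw [← hsum (rotate R x₀), Fin.sum_univ_two]
    simp [this]
  have ha : c₀ a = 1 / 2 := by
    fin_cases a
    · change c₀ 0 = 1 / 2
      linarith
    · change c₀ 1 = 1 / 2
      linarith
  exact ⟨c a, fun R => by rw [hc', ha]⟩

/-- Opposite directions have opposite biases. The rotations by signs take the default direction
`x₀` to `x₀` and to `-x₀` equally often, and their average is the zero matrix. -/
theorem apply_add_apply_neg_eq_one (hd : 2 ≤ d) (e : Fin 2 ⊕ Fin n ≃ Fin d)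
    (hT : TransformsFundamentally Q) (hU : Unbiased Q) (hsum : ∀ x, ∑ a, Q a x = 1) (a : Fin 2)
    (R : Rotation d) :
    Q a (rotate R (planarDirection e 1)) + Q a (-rotate R (planarDirection e 1)) = 1 := by
  classical
  have := Fintype.ofFinite (evenSigns d)
  obtain ⟨c, hc⟩ := exists_apply_rotate_eq_half_add hd hT hU hsum (planarDirection e 1) a
  set p := Q a (rotate R (planarDirection e 1))
  set q := Q a (-rotate R (planarDirection e 1))
  have h1 : ∀ ε : evenSigns d, (p + q) / 2 + ((ε.1 (e (Sum.inl 0)) : ℤ) : ℝ) * ((p - q) / 2) =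
      1 / 2 + ∑ i, ∑ j, ((ε.1 j : ℤ) : ℝ) * (R.1 i j * c i j) := by
    intro ε
    have h := hc (R * signRotation ε)
    rw [rotate_mul, rotate_signRotation_planarDirection_one] at h
    have h2 : ∀ i j, (R * signRotation ε).1 i j * c i j =
        ((ε.1 j : ℤ) : ℝ) * (R.1 i j * c i j) := by
      intro i j
      simp only [signRotation, Submonoid.coe_mul, Matrix.mul_diagonal]
      ring
    simp_rw [h2] at h
    rw [← h]
    rcases Int.units_eq_one_or (ε.1 (e (Sum.inl 0))) with hε | hε
    · simp only [hε, if_true, Units.val_one, Int.cast_one]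
      change _ = p
      ring
    · rw [hε, if_neg (by decide), rotate_neg]
      change _ = q
      simp
      ring
  have h2 := Finset.sum_congr rfl fun ε (_ : ε ∈ Finset.univ) => h1 ε
  have h3 : ∑ ε : evenSigns d, ∑ i, ∑ j, ((ε.1 j : ℤ) : ℝ) * (R.1 i j * c i j) = 0 := by
    rw [Finset.sum_comm]
    refine Finset.sum_eq_zero fun i _ => ?_
    rw [Finset.sum_comm]
    refine Finset.sum_eq_zero fun j _ => ?_
    rw [← Finset.sum_mul, sum_evenSigns_apply hd, zero_mul]
  rw [Finset.sum_add_distrib, Finset.sum_add_distrib, h3, ← Finset.sum_mul, sum_evenSigns_apply hd,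
    Finset.sum_const, Finset.sum_const] at h2
  have hN : (0 : ℝ) < (Finset.univ : Finset (evenSigns d)).card := by
    exact_mod_cast Finset.card_pos.2 ⟨1, Finset.mem_univ _⟩
  simp only [nsmul_eq_mul, zero_mul, add_zero] at h2
  have := mul_left_cancel₀ hN.ne' h2
  linarith

/-- On a plane of directions the probabilities are affine, with constant term `1 / 2`. -/
theorem exists_apply_rotate_planarDirection_eq (hd : 2 ≤ d) (e : Fin 2 ⊕ Fin n ≃ Fin d)
    (hT : TransformsFundamentally Q) (hU : Unbiased Q) (hsum : ∀ x, ∑ a, Q a x = 1)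
    (O : Rotation d) (a : Fin 2) :
    ∃ α β : ℝ, ∀ z : Circle,
      Q a (rotate O (planarDirection e z)) = 1 / 2 + α * (z : ℂ).re + β * (z : ℂ).im := by
  obtain ⟨c, hc⟩ := exists_apply_rotate_eq_half_add hd hT hU hsum (planarDirection e 1) a
  let G : Fin 3 → Matrix (Fin d) (Fin d) ℝ := ![
    (Matrix.fromBlocks 0 0 0 1).submatrix e.symm e.symm,
    (Matrix.fromBlocks 1 0 0 0).submatrix e.symm e.symm,
    (Matrix.fromBlocks !![0, -1; 1, 0] 0 0 0).submatrix e.symm e.symm]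
  let L : Fin 3 → ℝ := fun k => ∑ i, ∑ j, (O.1 * G k) i j * c i j
  have hG : ∀ z : Circle, (planarRotation e z).1 =
      G 0 + (z : ℂ).re • G 1 + (z : ℂ).im • G 2 := by
    intro z
    ext i j
    obtain ⟨i, rfl⟩ := e.surjective i
    obtain ⟨j, rfl⟩ := e.surjective j
    rcases i with i | i <;> rcases j with j | j
    · fin_cases i <;> fin_cases j <;> simp [planarRotation, G]
    · simp [planarRotation, G]
    · simp [planarRotation, G]
    · simp [planarRotation, G]
  have h : ∀ z : Circle, Q a (rotate O (planarDirection e z)) =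
      1 / 2 + (L 0 + (z : ℂ).re * L 1 + (z : ℂ).im * L 2) := by
    intro z
    rw [← rotate_planarRotation, ← rotate_mul, hc]
    simp only [Submonoid.coe_mul, hG, Matrix.mul_add, Matrix.mul_smul, Matrix.add_apply,
      Matrix.smul_apply, smul_eq_mul, L, Finset.mul_sum, ← Finset.sum_add_distrib]
    congr 1
    refine Finset.sum_congr rfl fun i _ => Finset.sum_congr rfl fun j _ => ?_
    ring
  have hL : L 0 = 0 := by
    have h1 := apply_add_apply_neg_eq_one hd e hT hU hsum a O
    rw [← rotate_neg, ← planarDirection_neg, h, h] at h1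
    simp at h1
    linarith
  exact ⟨L 1, L 2, fun z => by rw [h, hL]; ring⟩

end Planar

/-! ### From boxes to two-qubit states -/

/-- For a fixed outcome and input of Bob, the joint probabilities are affine on a plane of Alice's
directions, with half of Bob's marginal as the constant term. As conditional boxes are multiplied
by the marginal, this also holds where the marginal is zero and the conditional box undefined. -/
theorem exists_apply_eq_half_marginalB_add {d n : ℕ} (hd : 2 ≤ d) (e : Fin 2 ⊕ Fin n ≃ Fin d)
    {P : Fin 2 → Fin 2 → Direction d → Direction d → ℝ} (hP : IsNoSignallingBox P)
    (hT : TransformsFundamentallyLocally P) (hU : LocallyUnbiased P) (O : Rotation d) (a b : Fin 2)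
    (y : Direction d) :
    ∃ α β : ℝ, ∀ z : Circle, P a b (rotate O (planarDirection e z)) y =
      (P 0 b (rotate O (planarDirection e 1)) y + P 1 b (rotate O (planarDirection e 1)) y) / 2 +
        α * (z : ℂ).re + β * (z : ℂ).im := by
  set x₁ := rotate O (planarDirection e 1)
  have hm : ∀ x, marginalB P x b y = P 0 b x₁ y + P 1 b x₁ y := fun x => by
    rw [marginalB, hP.noSignal_B b y x x₁, Fin.sum_univ_two]
  rcases (add_nonneg (hP.nonneg 0 b x₁ y) (hP.nonneg 1 b x₁ y)).eq_or_lt' with h0 | h0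
  · refine ⟨0, 0, fun z => ?_⟩
    have h := hm (rotate O (planarDirection e z))
    rw [marginalB, h0, Finset.sum_eq_zero_iff_of_nonneg fun a _ => hP.nonneg a b _ y] at h
    rw [h a (Finset.mem_univ a), h0]
    simp
  · obtain ⟨α, β, h⟩ := exists_apply_rotate_planarDirection_eq hd e
      (hT.1 b y fun x => (hm x).symm ▸ h0) (hU.1 b y fun x => (hm x).symm ▸ h0)
      (fun x => by
        simp only [condBoxA]
        rw [← Finset.sum_div]
        exact div_self ((hm x).trans_ne h0.ne')) O a
    refine ⟨α * (P 0 b x₁ y + P 1 b x₁ y), β * (P 0 b x₁ y + P 1 b x₁ y), fun z => ?_⟩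
    have := h z
    rw [condBoxA, hm, div_eq_iff h0.ne'] at this
    rw [this]
    ring

/-- The box with the two parties exchanged. -/
def swapParties {A B X Y : Type*} (P : A → B → X → Y → ℝ) : B → A → Y → X → ℝ :=
  fun b a y x => P a b x y

theorem IsNoSignallingBox.swapParties {A B X Y : Type*} [Fintype A] [Fintype B]
    {P : A → B → X → Y → ℝ} (hP : IsNoSignallingBox P) : IsNoSignallingBox (swapParties P) where
  nonneg a b x y := hP.nonneg b a y x
  sum_eq_one x y := by
    rw [Finset.sum_comm]
    exact hP.sum_eq_one y x
  noSignal_A a x y y' := hP.noSignal_B a x y y'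
  noSignal_B b y x x' := hP.noSignal_A b y x x'

theorem AllConditionalBoxes.swapParties {A B X Y : Type*} [Fintype A] [Fintype B]
    {propA : (A → X → ℝ) → Prop} {propB : (B → Y → ℝ) → Prop} {P : A → B → X → Y → ℝ}
    (h : AllConditionalBoxes propA propB P) : AllConditionalBoxes propB propA (swapParties P) :=
  ⟨h.2, h.1⟩

/-- Flipping Alice's outcome has the same effect as reversing her direction. -/
theorem apply_one_eq_apply_zero_neg {d n : ℕ} (hd : 2 ≤ d) (e : Fin 2 ⊕ Fin n ≃ Fin d)
    {P : Fin 2 → Fin 2 → Direction d → Direction d → ℝ} (hP : IsNoSignallingBox P)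
    (hT : TransformsFundamentallyLocally P) (hU : LocallyUnbiased P) (O : Rotation d) (b : Fin 2)
    (y : Direction d) (z : Circle) :
    P 1 b (rotate O (planarDirection e z)) y = P 0 b (rotate O (planarDirection e (-z))) y := by
  obtain ⟨α, β, h⟩ := exists_apply_eq_half_marginalB_add hd e hP hT hU O 0 b y
  have h1 := h z
  have h2 := h (-z)
  have h3 := hP.noSignal_B b y (rotate O (planarDirection e z)) (rotate O (planarDirection e 1))
  simp only [Fin.sum_univ_two] at h3
  simp only [Circle.coe_neg, Complex.neg_re, Complex.neg_im] at h2
  linarith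

/-- A function on two circles that is affine in each argument is bi-affine. -/
theorem exists_eq_biAffine (F : Circle → Circle → ℝ)
    (hl : ∀ w, ∃ h α β : ℝ, ∀ z : Circle, F z w = h + α * (z : ℂ).re + β * (z : ℂ).im)
    (hr : ∀ z, ∃ h α β : ℝ, ∀ w : Circle, F z w = h + α * (w : ℂ).re + β * (w : ℂ).im) :
    ∃ M : Fin 3 → Fin 3 → ℝ, ∀ z w : Circle, F z w = biAffine M z w := by
  let ι : Circle := ⟨Complex.I, by simp [Submonoid.unitSphere]⟩
  obtain ⟨h₁, α₁, β₁, H₁⟩ := hr 1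
  obtain ⟨h₂, α₂, β₂, H₂⟩ := hr (-1)
  obtain ⟨h₃, α₃, β₃, H₃⟩ := hr ι
  refine ⟨![![(h₁ + h₂) / 2, (α₁ + α₂) / 2, (β₁ + β₂) / 2],
    ![(h₁ - h₂) / 2, (α₁ - α₂) / 2, (β₁ - β₂) / 2],
    ![h₃ - (h₁ + h₂) / 2, α₃ - (α₁ + α₂) / 2, β₃ - (β₁ + β₂) / 2]], fun z w => ?_⟩
  obtain ⟨h, α, β, H⟩ := hl w
  have e1 : h + α = h₁ + α₁ * (w : ℂ).re + β₁ * (w : ℂ).im := by rw [← H₁, H]; simp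
  have e2 : h - α = h₂ + α₂ * (w : ℂ).re + β₂ * (w : ℂ).im := by rw [← H₂, H]; simp; ring
  have e3 : h + β = h₃ + α₃ * (w : ℂ).re + β₃ * (w : ℂ).im := by rw [← H₃, H]; simp [ι]
  rw [H]
  simp [biAffine, affineCoord, Fin.sum_univ_three]
  linear_combination (1 / 2 + (z : ℂ).re / 2 - (z : ℂ).im / 2) * e1
    + (1 / 2 - (z : ℂ).re / 2 - (z : ℂ).im / 2) * e2 + (z : ℂ).im * e3

/-- A box behaviour is obtained by planar qubit measurements on a two-qubit state. On the two
planes of directions the box is a bi-affine function `F` of unit complex numbers, and a change of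
outcome amounts to the opposite direction, so that `F` determines all of its probabilities. -/
theorem exists_qubit_state_of_mem_boxBehaviours {d : ℕ} (hd : 2 ≤ d) {p : Table222}
    (hp : p ∈ boxBehaviours d) :
    ∃ (ρ : Matrix (Fin 2 × Fin 2) (Fin 2 × Fin 2) ℂ) (z w : Fin 2 → Circle), IsDensityMatrix ρ ∧
      ∀ a b r t, (p a b r t : ℂ) = (ρ * (qubitEffect (outcomeSign a • (z r : ℂ)) ⊗ₖ
        qubitEffect (outcomeSign b • (w t : ℂ)))).trace := by
  obtain ⟨P, hP, hT, hU, x, y, hpP⟩ := hp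
  obtain ⟨n, rfl⟩ := Nat.exists_eq_add_of_le hd
  let e : Fin 2 ⊕ Fin n ≃ Fin (2 + n) := finSumFinEquiv
  obtain ⟨O, z, hz⟩ := exists_rotate_planarDirection_eq e x
  obtain ⟨O', w, hw⟩ := exists_rotate_planarDirection_eq e y
  have hP' := hP.swapParties
  have hT' : TransformsFundamentallyLocally (swapParties P) := AllConditionalBoxes.swapParties hT
  have hU' : LocallyUnbiased (swapParties P) := AllConditionalBoxes.swapParties hU
  let F : Circle → Circle → ℝ := fun z w =>
    P 0 0 (rotate O (planarDirection e z)) (rotate O' (planarDirection e w))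
  have hF : ∀ a b z w, P a b (rotate O (planarDirection e z)) (rotate O' (planarDirection e w)) =
      F (if a = 0 then z else -z) (if b = 0 then w else -w) := by
    have hA := fun b y z => apply_one_eq_apply_zero_neg hd e hP hT hU O b y z
    have hB : ∀ a x w, P a 1 x (rotate O' (planarDirection e w)) =
        P a 0 x (rotate O' (planarDirection e (-w))) :=
      fun a x w => apply_one_eq_apply_zero_neg hd e hP' hT' hU' O' a x w
    intro a b z w
    fin_cases a <;> fin_cases b <;> simp [F, hA, hB]
  obtain ⟨M, hM⟩ := exists_eq_biAffine F
    (fun w => by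
      obtain ⟨α, β, h⟩ := exists_apply_eq_half_marginalB_add hd e hP hT hU O 0 0
        (rotate O' (planarDirection e w))
      exact ⟨_, α, β, h⟩)
    (fun z => by
      obtain ⟨α, β, h⟩ := exists_apply_eq_half_marginalB_add hd e hP' hT' hU' O' 0 0
        (rotate O (planarDirection e z))
      exact ⟨_, α, β, h⟩)
  obtain ⟨ρ, hρ, hρt, hρM⟩ := exists_posSemidef_of_biAffine_nonneg M (fun z w hz hw => by
    have := hM ⟨z, mem_sphere_zero_iff_norm.2 hz⟩ ⟨w, mem_sphere_zero_iff_norm.2 hw⟩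
    change _ = biAffine M z w at this
    rw [← this]
    exact hP.nonneg _ _ _ _)
  have hsign : ∀ (a : Fin 2) (z : Circle),
      outcomeSign a • (z : ℂ) = ((if a = 0 then z else -z : Circle) : ℂ) := by
    intro a z
    fin_cases a <;> simp
  refine ⟨ρ, z, w, ⟨hρ, ?_⟩, fun a b r t => ?_⟩
  · rw [hρt]
    have h := hP.sum_eq_one (rotate O (planarDirection e 1)) (rotate O' (planarDirection e 1))
    simp only [hF, hM, Fin.sum_univ_two] at h
    simp [biAffine, affineCoord, Fin.sum_univ_three] at h
    rw [show 4 * M 0 0 = 1 by linarith]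
    simp
  · rw [hpP, hz, hw, hF, hM, hρM, hsign, hsign]

/-! ### Mixtures of quantum behaviours -/

theorem mem_quantumBehaviours {ι κ : Type*} [Fintype ι] [DecidableEq ι] [Fintype κ]
    [DecidableEq κ] {p : Table222} {ρ : Matrix (ι × κ) (ι × κ) ℂ}
    {E : Fin 2 → Fin 2 → Matrix ι ι ℂ} {F : Fin 2 → Fin 2 → Matrix κ κ ℂ}
    (hρ : IsDensityMatrix ρ) (hE : ∀ r, IsPOVM (E r)) (hF : ∀ t, IsPOVM (F t))
    (hp : ∀ a b r t, (p a b r t : ℂ) = (ρ * (E r a ⊗ₖ F t b)).trace) : p ∈ quantumBehaviours := by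
  let e := (Fintype.equivFin ι).symm
  let f := (Fintype.equivFin κ).symm
  have htr : ∀ A : Matrix (ι × κ) (ι × κ) ℂ,
      (A.submatrix (e.prodCongr f) (e.prodCongr f)).trace = A.trace := fun A =>
    (e.prodCongr f).sum_comp fun i => A i i
  refine ⟨Fintype.card ι, Fintype.card κ, ρ.submatrix (e.prodCongr f) (e.prodCongr f),
    fun r a => (E r a).submatrix e e, fun t b => (F t b).submatrix f f, ⟨hρ.1.submatrix _, ?_⟩,
    fun r => ⟨fun a => ((hE r).1 a).submatrix _, ?_⟩,
    fun t => ⟨fun b => ((hF t).1 b).submatrix _, ?_⟩, fun a b r t => ?_⟩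
  · rw [htr, hρ.2]
  · rw [← Matrix.submatrix_one_equiv e, ← (hE r).2]
    ext i j
    simp [Matrix.sum_apply]
  · rw [← Matrix.submatrix_one_equiv f, ← (hF t).2]
    ext i j
    simp [Matrix.sum_apply]
  · rw [hp, ← htr, ← Matrix.submatrix_mul_equiv _ _ _ (e.prodCongr f)]
    rfl

/-- The isometry that embeds the summand `k` into a direct sum. -/
def summandIsometry {K : Type*} [DecidableEq K] (ι : K → Type*) [∀ k, DecidableEq (ι k)] (k : K) :
    Matrix (Σ k, ι k) (ι k) ℂ :=
  (1 : Matrix (Σ k, ι k) (Σ k, ι k) ℂ).submatrix id (Sigma.mk k)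

section Summand

variable {K : Type*} [Fintype K] [DecidableEq K] {ι : K → Type*} [∀ k, Fintype (ι k)]
  [∀ k, DecidableEq (ι k)]

theorem conjTranspose_summandIsometry_mul_self (ι : K → Type*) [∀ k, Fintype (ι k)]
    [∀ k, DecidableEq (ι k)] (k : K) :
    (summandIsometry ι k)ᴴ * summandIsometry ι k = 1 := by
  ext i j
  simp [summandIsometry, Matrix.mul_apply, Matrix.one_apply]

theorem conjTranspose_summandIsometry_mul_of_ne (ι : K → Type*) [∀ k, Fintype (ι k)]
    [∀ k, DecidableEq (ι k)] {k l : K} (h : k ≠ l) :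
    (summandIsometry ι k)ᴴ * summandIsometry ι l = 0 := by
  ext i j
  simp [summandIsometry, Matrix.mul_apply, Matrix.one_apply, h]

theorem sum_summandIsometry_mul_conjTranspose (ι : K → Type*) [∀ k, Fintype (ι k)]
    [∀ k, DecidableEq (ι k)] :
    ∑ k, (summandIsometry ι k) * (summandIsometry ι k)ᴴ = 1 := by
  ext ⟨i, a⟩ ⟨j, b⟩
  have h : ∀ k, (summandIsometry ι k * (summandIsometry ι k)ᴴ) ⟨i, a⟩ ⟨j, b⟩ =
      ∑ c : ι k, (if (⟨i, a⟩ : Σ k, ι k) = ⟨k, c⟩ then 1 else 0) *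
        (if (⟨j, b⟩ : Σ k, ι k) = ⟨k, c⟩ then 1 else 0) := by
    intro k
    rw [Matrix.mul_apply]
    refine Finset.sum_congr rfl fun c _ => ?_
    simp only [summandIsometry, Matrix.conjTranspose_apply, Matrix.submatrix_apply, id,
      Matrix.one_apply]
    split_ifs <;> simp
  simp only [Matrix.sum_apply, h]
  rw [← Fintype.sum_sigma' fun k (c : ι k) =>
        (if (⟨i, a⟩ : Σ k, ι k) = ⟨k, c⟩ then (1 : ℂ) else 0) *
        (if (⟨j, b⟩ : Σ k, ι k) = ⟨k, c⟩ then 1 else 0)]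
  simp only [Sigma.eta, ite_mul, one_mul, zero_mul, Finset.sum_ite_eq, Finset.mem_univ, if_true,
    Matrix.one_apply]
  exact if_congr eq_comm rfl rfl

/-- The block diagonal operator with blocks `A k`. -/
def blockSum (A : ∀ k, Matrix (ι k) (ι k) ℂ) : Matrix (Σ k, ι k) (Σ k, ι k) ℂ :=
  ∑ k, summandIsometry ι k * A k * (summandIsometry ι k)ᴴ

theorem conjTranspose_summandIsometry_mul_blockSum_mul (A : ∀ k, Matrix (ι k) (ι k) ℂ) (k : K) :
    (summandIsometry ι k)ᴴ * blockSum A * summandIsometry ι k = A k := by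
  rw [blockSum, Matrix.mul_sum, Matrix.sum_mul, Finset.sum_eq_single k]
  · simp only [← Matrix.mul_assoc, conjTranspose_summandIsometry_mul_self, Matrix.one_mul]
    rw [Matrix.mul_assoc, conjTranspose_summandIsometry_mul_self, Matrix.mul_one]
  · intro l _ hl
    simp only [← Matrix.mul_assoc, conjTranspose_summandIsometry_mul_of_ne ι hl.symm,
      Matrix.zero_mul]
  · simp

theorem isPOVM_blockSum {A : Type*} [Fintype A] {E : ∀ k, A → Matrix (ι k) (ι k) ℂ}
    (hE : ∀ k, IsPOVM (E k)) : IsPOVM fun a => blockSum fun k => E k a where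
  posSemidef a := Matrix.posSemidef_sum _ fun k _ =>
    ((hE k).1 a).mul_mul_conjTranspose_same _
  sum_eq_one := by
    simp only [blockSum]
    rw [Finset.sum_comm, ← sum_summandIsometry_mul_conjTranspose]
    refine Finset.sum_congr rfl fun k _ => ?_
    rw [← Matrix.sum_mul, ← Matrix.mul_sum, (hE k).2, Matrix.mul_one]

end Summand

/-- Mixtures of quantum behaviours are quantum: both parties hold a copy of the shared random
variable `k` and use the direct sum of their Hilbert spaces. -/
theorem sharedRandomnessMixtures_quantumBehaviours_subset :
    sharedRandomnessMixtures quantumBehaviours ⊆ quantumBehaviours := by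
  rintro p ⟨N, w, q, hw, hw1, hq, hp⟩
  choose m n ρ E F hρ hE hF hqE using hq
  let V : ∀ k, Matrix ((Σ k, Fin (m k)) × (Σ k, Fin (n k))) (Fin (m k) × Fin (n k)) ℂ :=
    fun k => summandIsometry (fun k => Fin (m k)) k ⊗ₖ summandIsometry (fun k => Fin (n k)) k
  have htr : ∀ k, ((V k) * ρ k * (V k)ᴴ).trace = 1 := by
    intro k
    rw [Matrix.trace_mul_comm, ← Matrix.mul_assoc, Matrix.conjTranspose_kronecker,
      ← Matrix.mul_kronecker_mul, conjTranspose_summandIsometry_mul_self,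
      conjTranspose_summandIsometry_mul_self, Matrix.one_kronecker_one, Matrix.one_mul, (hρ k).2]
  refine mem_quantumBehaviours (ρ := ∑ k, w k • (V k * ρ k * (V k)ᴴ))
    (E := fun r a => blockSum fun k => E k r a) (F := fun t b => blockSum fun k => F k t b)
    ⟨Matrix.posSemidef_sum _ fun k _ => ((hρ k).1.mul_mul_conjTranspose_same _).smul (hw k), ?_⟩
    (fun r => isPOVM_blockSum fun k => hE k r) (fun t => isPOVM_blockSum fun k => hF k t)
    fun a b r t => ?_
  · simp only [Matrix.trace_sum, Matrix.trace_smul, htr]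
    simp only [Complex.real_smul, mul_one]
    exact_mod_cast hw1
  · rw [hp, Matrix.sum_mul, Matrix.trace_sum]
    push_cast
    refine Finset.sum_congr rfl fun k _ => ?_
    rw [hqE, Matrix.smul_mul, Matrix.trace_smul, Complex.real_smul, Matrix.mul_assoc,
      Matrix.trace_mul_comm (V k * ρ k), ← Matrix.mul_assoc, Matrix.trace_mul_comm _ (ρ k)]
    simp only [V]
    rw [Matrix.conjTranspose_kronecker, ← Matrix.mul_kronecker_mul, ← Matrix.mul_kronecker_mul,
      conjTranspose_summandIsometry_mul_blockSum_mul,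
      conjTranspose_summandIsometry_mul_blockSum_mul]

theorem sharedRandomnessMixtures_mono {S T : Set Table222} (h : S ⊆ T) :
    sharedRandomnessMixtures S ⊆ sharedRandomnessMixtures T := by
  rintro p ⟨N, w, q, hw, hw1, hq, hp⟩
  exact ⟨N, w, q, hw, hw1, fun k => h (hq k), hp⟩

theorem mem_sharedRandomnessMixtures {K : Type*} [Fintype K] {S : Set Table222} {p : Table222}
    {w : K → ℝ} {q : K → Table222} (hw : ∀ k, 0 ≤ w k) (hw1 : ∑ k, w k = 1) (hq : ∀ k, q k ∈ S)
    (hp : ∀ a b r t, p a b r t = ∑ k, w k * q k a b r t) : p ∈ sharedRandomnessMixtures S := by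
  let e := (Fintype.equivFin K).symm
  refine ⟨Fintype.card K, w ∘ e, q ∘ e, fun k => hw _, ?_, fun k => hq _, fun a b r t => ?_⟩
  · rw [← hw1, ← e.sum_comp]
    rfl
  · rw [hp, ← e.sum_comp]
    rfl

theorem boxBehaviours_subset_quantumBehaviours {d : ℕ} (hd : 2 ≤ d) :
    boxBehaviours d ⊆ quantumBehaviours := by
  intro p hp
  obtain ⟨ρ, z, w, hρ, h⟩ := exists_qubit_state_of_mem_boxBehaviours hd hp
  exact ⟨2, 2, ρ, _, _, hρ, fun r => isPOVM_qubitEffect (z r).norm_coe.le,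
    fun t => isPOVM_qubitEffect (w t).norm_coe.le, h⟩

/-! ### Pairs of measurements as compressions of qubit measurements -/

open scoped Matrix.Norms.L2Operator in
/-- The spectral theorem for a unitary matrix, as a decomposition into spectral projections. -/
theorem Matrix.exists_spectral_decomposition_of_mem_unitary {ι : Type*} [Fintype ι] [DecidableEq ι]
    {W : Matrix ι ι ℂ} (hW : W ∈ unitary (Matrix ι ι ℂ)) :
    ∃ (s : Finset ℂ) (T : ℂ → Matrix ι ι ℂ), (∀ z ∈ s, ‖z‖ = 1) ∧
      (∑ z ∈ s, (T z)ᴴ * T z = 1) ∧ ∑ z ∈ s, z • ((T z)ᴴ * T z) = W := by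
  have hfin : (spectrum ℂ W).Finite := Matrix.finite_spectrum W
  have hn : IsStarNormal W := by
    constructor
    rw [Commute, SemiconjBy, hW.1, hW.2]
  have hc : ∀ f : ℂ → ℂ, ContinuousOn f (spectrum ℂ W) := fun f => hfin.continuousOn f
  let T : ℂ → Matrix ι ι ℂ := fun z => cfc (fun x => if x = z then (1 : ℂ) else 0) W
  have hT : ∀ z, (T z)ᴴ * T z = cfc (fun x => if x = z then (1 : ℂ) else 0) W := by
    intro z
    rw [← Matrix.star_eq_conjTranspose, ← cfc_star, ← cfc_mul _ _ _ (hc _) (hc _)]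
    congr 1
    ext x
    split_ifs <;> simp
  refine ⟨hfin.toFinset, T, fun z hz => ?_, ?_, ?_⟩
  · have := spectrum.subset_circle_of_unitary hW (hfin.mem_toFinset.1 hz)
    simpa using this
  · simp_rw [hT]
    rw [← cfc_sum _ _ _ (fun _ _ => hc _), ← cfc_one ℂ W]
    refine cfc_congr fun x hx => ?_
    simp [hx]
  · simp_rw [hT]
    simp_rw [← cfc_const_mul _ _ W (hc _)]
    rw [← cfc_sum _ _ _ (fun _ _ => hc _)]
    conv_rhs => rw [← cfc_id ℂ W]
    refine cfc_congr fun x hx => ?_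
    simp [hx]

/-- The observable `re z σ_z + im z σ_x` with outcomes `±1`, whose effects are
`qubitEffect (± z)`. -/
def qubitObservable (z : ℂ) : Matrix (Fin 2) (Fin 2) ℂ :=
  !![(z.re : ℂ), (z.im : ℂ); (z.im : ℂ), -(z.re : ℂ)]

theorem qubitEffect_eq_smul_one_add (s : ℝ) (z : ℂ) :
    qubitEffect (s • z) = (1 / 2 : ℂ) • (1 + (s : ℂ) • qubitObservable z) := by
  ext i j
  fin_cases i <;> fin_cases j <;> simp [qubitEffect, qubitObservable] <;> ring

/-- The operators considered map to `ℂ²`, with the `i`-th rows of `R 0` and `R 1` as their rows. -/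
theorem sum_conjTranspose_rows_mul_mul {ι : Type*} [Fintype ι] (R : Fin 2 → Matrix ι ι ℂ)
    (B : Matrix (Fin 2) (Fin 2) ℂ) :
    ∑ i, (Matrix.of fun p => R p i)ᴴ * B * (Matrix.of fun p => R p i) =
      ∑ p, ∑ q, B p q • ((R p)ᴴ * R q) := by
  ext j k
  simp only [Fin.sum_univ_two, Matrix.sum_apply, Matrix.add_apply, Matrix.smul_apply,
    Matrix.mul_apply, Matrix.conjTranspose_apply, Matrix.of_apply, smul_eq_mul, Finset.mul_sum,
    ← Finset.sum_add_distrib]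
  refine Finset.sum_congr rfl fun i _ => ?_
  ring

/-- Jordan's lemma, in the form of a Kraus decomposition: two reflections `U 0`, `U 1` are
simultaneously compressed to qubit observables in a plane. For an eigenvector `v` of
`W = U 0 * U 1` with eigenvalue `z`, the pair `v`, `U 0 v` spans an invariant subspace, on which
the angle between the two observables is that of `z`; the Kraus operator is built from the two
functionals `v*` and `v* (U 0)`, and summing over an eigenbasis makes it unnecessary to discuss
whether the two vectors are independent. -/
theorem exists_kraus_of_reflections {ι : Type} [Fintype ι] [DecidableEq ι]
    (U : Fin 2 → Matrix ι ι ℂ) (hU : ∀ r, (U r)ᴴ = U r) (hUU : ∀ r, U r * U r = 1) :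
    ∃ (κ : Type) (_ : Fintype κ) (A : κ → Matrix (Fin 2) ι ℂ) (z : κ → Fin 2 → Circle),
      ∑ k, (A k)ᴴ * A k = 1 ∧
        ∀ r, ∑ k, (A k)ᴴ * qubitObservable (z k r) * A k = U r := by
  set V := U 0 with hV
  have hVV : V * V = 1 := hUU 0
  have hVh : Vᴴ = V := hU 0
  have hWh : (V * U 1)ᴴ = U 1 * V := by rw [Matrix.conjTranspose_mul, hU, hVh]
  have hW : V * U 1 ∈ unitary (Matrix ι ι ℂ) := by
    constructor
    · rw [Matrix.star_eq_conjTranspose, hWh, Matrix.mul_assoc, ← Matrix.mul_assoc V V, hVV,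
        Matrix.one_mul, hUU]
    · rw [Matrix.star_eq_conjTranspose, hWh, Matrix.mul_assoc, ← Matrix.mul_assoc (U 1) (U 1), hUU,
        Matrix.one_mul, hVV]
  obtain ⟨s, T, hs, hT1, hTW⟩ := Matrix.exists_spectral_decomposition_of_mem_unitary hW
  rw [← Finset.sum_coe_sort] at hT1 hTW
  -- With `R z = (T z, T z * V) / √2`, the observables for `V` and `U 1` would be `σ_x` and
  -- `re z σ_x + im z σ_y`; a change of basis of `ℂ²` turns `σ_x`, `σ_y` into `σ_z`, `σ_x`.
  let R : ℂ → Fin 2 → Matrix ι ι ℂ := fun z =>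
    ![(1 / 2 : ℂ) • (T z + T z * V), (Complex.I / 2) • (T z - T z * V)]
  let z : s × ι → Fin 2 → Circle := fun k =>
    ![1, ⟨k.1, mem_sphere_zero_iff_norm.2 (hs k.1 k.1.2)⟩]
  have hstar : ∑ z : s, star (z : ℂ) • ((T z)ᴴ * T z) = U 1 * V := by
    rw [← hWh, ← hTW, Matrix.conjTranspose_sum]
    refine Finset.sum_congr rfl fun z _ => ?_
    rw [Matrix.conjTranspose_smul, Matrix.conjTranspose_mul, Matrix.conjTranspose_conjTranspose]
  -- the value of each Kraus term after summation over the rows of `T z`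
  have hone : ∀ z, ∑ p, ∑ q, (1 : Matrix (Fin 2) (Fin 2) ℂ) p q • ((R z p)ᴴ * R z q) =
      (1 / 2 : ℂ) • ((T z)ᴴ * T z + V * ((T z)ᴴ * T z) * V) := by
    intro z
    simp only [R, Fin.sum_univ_two, Matrix.cons_val_zero, Matrix.cons_val_one,
      Matrix.conjTranspose_smul, Matrix.conjTranspose_add, Matrix.conjTranspose_sub,
      Matrix.conjTranspose_mul, hVh, Matrix.one_apply]
    simp [Matrix.mul_add, Matrix.add_mul, Matrix.mul_sub, Matrix.sub_mul, Matrix.mul_assoc,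
      smul_smul]
    match_scalars <;> first
      | ring1
      | linear_combination (-1 / 4) * Complex.I_sq
      | linear_combination (1 / 4) * Complex.I_sq
  have hobs : ∀ z u : ℂ, ∑ p, ∑ q, qubitObservable u p q • ((R z p)ᴴ * R z q) =
      (1 / 2 : ℂ) • ((star u • ((T z)ᴴ * T z)) * V + V * (u • ((T z)ᴴ * T z))) := by
    intro z u
    have hu : u = u.re + u.im * Complex.I := (Complex.re_add_im u).symm
    have hus : star u = u.re - u.im * Complex.I := by
      apply Complex.ext <;> simp
    rw [hus]
    simp only [R, qubitObservable, Fin.sum_univ_two, Matrix.cons_val_zero, Matrix.cons_val_one,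
      Matrix.conjTranspose_smul, Matrix.conjTranspose_add, Matrix.conjTranspose_sub,
      Matrix.conjTranspose_mul, hVh]
    simp [Matrix.mul_add, Matrix.add_mul, Matrix.mul_sub, Matrix.sub_mul, Matrix.mul_assoc,
      smul_smul]
    match_scalars <;> first
      | ring1
      | linear_combination (u.re / 4 : ℂ) * Complex.I_sq
      | linear_combination (-u.re / 4 : ℂ) * Complex.I_sq
      | linear_combination (-u.re / 4 : ℂ) * Complex.I_sq - (1 / 2) * hu
  refine ⟨s × ι, inferInstance, fun k => Matrix.of fun p => R k.1 p k.2, z, ?_, fun r => ?_⟩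
  · have h : ∀ z : s, ∑ i, (Matrix.of fun p => R z p i)ᴴ * (Matrix.of fun p => R z p i) =
        (1 / 2 : ℂ) • ((T z)ᴴ * T z + V * ((T z)ᴴ * T z) * V) := fun z => by
      rw [← hone, ← sum_conjTranspose_rows_mul_mul]
      simp
    rw [Fintype.sum_prod_type]
    simp only [h]
    rw [← Finset.smul_sum, Finset.sum_add_distrib, ← Matrix.sum_mul, ← Matrix.mul_sum, hT1,
      Matrix.mul_one, hVV, ← two_smul ℂ, smul_smul]
    norm_num
  · rw [Fintype.sum_prod_type]
    fin_cases r
    · have h : ∀ z : s, ∑ i, (Matrix.of fun p => R z p i)ᴴ * qubitObservable 1 *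
          (Matrix.of fun p => R z p i) = _ := fun z => by
        rw [sum_conjTranspose_rows_mul_mul, hobs]
      change ∑ z : s, ∑ i, (Matrix.of fun p => R z p i)ᴴ * qubitObservable 1 *
          (Matrix.of fun p => R z p i) = V
      simp only [h, star_one, one_smul]
      rw [← Finset.smul_sum, Finset.sum_add_distrib, ← Matrix.sum_mul, ← Matrix.mul_sum, hT1,
        Matrix.mul_one, Matrix.one_mul, ← two_smul ℂ, smul_smul]
      norm_num
    · have h : ∀ z : s, ∑ i, (Matrix.of fun p => R z p i)ᴴ * qubitObservable (z : ℂ) *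
          (Matrix.of fun p => R z p i) = _ := fun z => by
        rw [sum_conjTranspose_rows_mul_mul, hobs]
      change ∑ z : s, ∑ i, (Matrix.of fun p => R z p i)ᴴ * qubitObservable (z : ℂ) *
          (Matrix.of fun p => R z p i) = U 1
      simp only [h]
      rw [← Finset.smul_sum, Finset.sum_add_distrib, ← Matrix.sum_mul, ← Matrix.mul_sum, hTW,
        hstar, Matrix.mul_assoc, hVV, ← Matrix.mul_assoc, hVV, Matrix.mul_one, Matrix.one_mul,
        ← two_smul ℂ, smul_smul]
      norm_num

open scoped Matrix.Norms.L2Operator MatrixOrder in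
/-- The square root of `E 0 * E 1` for a measurement with effects `E 0`, `E 1`, which commute as
their sum is `1`. Twice this matrix is the off-diagonal block of the dilation of `E 0 - E 1` to a
reflection. -/
theorem IsPOVM.exists_sqrt {ι : Type*} [Fintype ι] [DecidableEq ι]
    {E : Fin 2 → Matrix ι ι ℂ} (hE : IsPOVM E) :
    ∃ S : Matrix ι ι ℂ, Sᴴ = S ∧ S * S = E 0 * E 1 ∧ Commute S (E 0) ∧ Commute S (E 1) := by
  have h01 : E 1 = 1 - E 0 := by rw [← hE.2, Fin.sum_univ_two]; abel
  have hc : Commute (E 0) (E 1) := by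
    rw [h01]
    exact (Commute.one_right _).sub_right (Commute.refl _)
  have hpos : (E 0 * E 1).PosSemidef := by
    have h : E 0 * E 1 = E 0 * E 1 * (E 0)ᴴ + E 1 * E 0 * (E 1)ᴴ := by
      rw [(hE.1 0).1, (hE.1 1).1, ← hc.eq, ← Matrix.mul_add, ← Fin.sum_univ_two, hE.2,
        Matrix.mul_one]
    rw [h]
    exact ((hE.1 1).mul_mul_conjTranspose_same _).add ((hE.1 0).mul_mul_conjTranspose_same _)
  have hsq : ∀ B, Commute (E 0 * E 1) B → Commute (CFC.sqrt (E 0 * E 1)) B := by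
    intro B hB
    rw [CFC.sqrt]
    exact hB.cfcₙ_nnreal _
  refine ⟨CFC.sqrt (E 0 * E 1), (Matrix.nonneg_iff_posSemidef.1 (CFC.sqrt_nonneg _)).1,
    CFC.sqrt_mul_sqrt_self _ hpos.nonneg, hsq _ ?_, hsq _ ?_⟩
  · exact (Commute.refl _).mul_left hc.symm
  · exact hc.mul_left (Commute.refl _)

/-- Two measurements with two outcomes arise together from planar qubit measurements, preceded by
an operation with Kraus operators `A k` whose outcome `k` fixes the two Bloch vectors. Both
measurements are first dilated to reflections, with the same embedding `J`. -/
theorem exists_kraus_of_isPOVM {ι : Type} [Fintype ι] [DecidableEq ι]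
    {E : Fin 2 → Fin 2 → Matrix ι ι ℂ} (hE : ∀ r, IsPOVM (E r)) :
    ∃ (κ : Type) (_ : Fintype κ) (A : κ → Matrix (Fin 2) ι ℂ) (z : κ → Fin 2 → Circle),
      ∀ r a, E r a = ∑ k, (A k)ᴴ * qubitEffect (outcomeSign a • (z k r : ℂ)) * A k := by
  choose S hS hSS hS0 hS1 using fun r => (hE r).exists_sqrt
  have hsum : ∀ r, E r 0 + E r 1 = 1 := fun r => by rw [← (hE r).2, Fin.sum_univ_two]
  have hE1 : ∀ r, E r 1 = 1 - E r 0 := fun r => by rw [← hsum r]; abel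
  let U : Fin 2 → Matrix (ι ⊕ ι) (ι ⊕ ι) ℂ := fun r =>
    Matrix.fromBlocks (E r 0 - E r 1) ((2 : ℂ) • S r) ((2 : ℂ) • S r) (E r 1 - E r 0)
  have hU : ∀ r, (U r)ᴴ = U r := fun r => by
    simp only [U, Matrix.fromBlocks_conjTranspose, Matrix.conjTranspose_sub,
      Matrix.conjTranspose_smul, hS, ((hE r).1 _).1.eq]
    simp
  have hUU : ∀ r, U r * U r = 1 := fun r => by
    have h1 : (E r 0 - E r 1) * (E r 0 - E r 1) + ((2 : ℂ) • S r) * ((2 : ℂ) • S r) = 1 := by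
      rw [Matrix.smul_mul, Matrix.mul_smul, smul_smul, hSS, hE1]
      norm_num [sub_mul, mul_sub]
      module
    have h2 : (E r 0 - E r 1) * ((2 : ℂ) • S r) + ((2 : ℂ) • S r) * (E r 1 - E r 0) = 0 := by
      rw [Matrix.mul_smul, Matrix.smul_mul, ← smul_add, sub_mul, mul_sub, (hS0 r).eq, (hS1 r).eq]
      simp
    simp only [U, Matrix.fromBlocks_multiply]
    rw [h1, h2, ← Matrix.fromBlocks_one]
    congr 1
    · rw [← h2]
      simp only [mul_sub, sub_mul, Matrix.mul_smul, Matrix.smul_mul, (hS0 r).eq, (hS1 r).eq]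
    · rw [← h1]
      simp only [mul_sub, sub_mul]
      abel
  obtain ⟨κ, _, A, z, hA, hAU⟩ := exists_kraus_of_reflections U hU hUU
  let J : Matrix (ι ⊕ ι) ι ℂ := Matrix.fromRows 1 0
  have hJ1 : Jᴴ * J = 1 := by
    simp [J, Matrix.conjTranspose_fromRows_eq_fromCols_conjTranspose, Matrix.fromCols_mul_fromRows]
  have hJU : ∀ r, Jᴴ * U r * J = E r 0 - E r 1 := fun r => by
    simp [J, U, Matrix.conjTranspose_fromRows_eq_fromCols_conjTranspose,
      Matrix.fromCols_mul_fromRows, Matrix.fromCols_mul_fromBlocks]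
  refine ⟨κ, inferInstance, fun k => A k * J, z, fun r a => ?_⟩
  have h : ∑ k, (A k * J)ᴴ * qubitEffect (outcomeSign a • (z k r : ℂ)) * (A k * J) =
      (1 / 2 : ℂ) • (1 + (outcomeSign a : ℂ) • (E r 0 - E r 1)) := by
    have hJA : (1 : Matrix ι ι ℂ) = Jᴴ * (∑ k, (A k)ᴴ * A k) * J := by
      rw [hA, Matrix.mul_one, hJ1]
    rw [← hJU, hJA, ← hAU r]
    simp only [qubitEffect_eq_smul_one_add, Matrix.mul_sum, Matrix.sum_mul, Finset.smul_sum,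
      ← Finset.sum_add_distrib, Matrix.conjTranspose_mul]
    refine Finset.sum_congr rfl fun k _ => ?_
    simp only [Matrix.mul_smul, Matrix.smul_mul, Matrix.mul_add, Matrix.add_mul, Matrix.mul_one,
      Matrix.mul_assoc]
  rw [h, ← hsum r]
  fin_cases a
  · simp
    module
  · simp
    module

/-! ### Boxes from two-qubit states -/

theorem sum_mul_rotate_apply {d : ℕ} (v : Fin d → ℝ) (R : Rotation d) (x : Direction d) :
    ∑ i, v i * (rotate R x).1 i = ∑ i, ∑ j, R.1 i j * (x.1 j * v i) := by
  refine Finset.sum_congr rfl fun i _ => ?_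
  simp only [rotate, Matrix.mulVec, dotProduct, Finset.mul_sum]
  exact Finset.sum_congr rfl fun j _ => by ring

theorem transformsFundamentally_and_unbiased_of_eq {d : ℕ} (hd : 2 ≤ d)
    {Q : Fin 2 → Direction d → ℝ} (v : Fin d → ℝ)
    (hQ : ∀ a x, Q a x = 1 / 2 + outcomeSign a * ∑ i, v i * x.1 i) :
    TransformsFundamentally Q ∧ Unbiased Q := by
  have h : ∀ (x : Direction d) (R : Rotation d) (a : Fin 2), Q a (rotate R x) =
      1 / 2 + ∑ i, ∑ j, R.1 i j * (outcomeSign a * (x.1 j * v i)) := by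
    intro x R a
    rw [hQ, sum_mul_rotate_apply, Finset.mul_sum]
    congr 1
    refine Finset.sum_congr rfl fun i _ => ?_
    rw [Finset.mul_sum]
    exact Finset.sum_congr rfl fun j _ => by ring
  refine ⟨fun x₀ => ⟨fun _ => 1 / 2, fun a i j => outcomeSign a * (x₀.1 j * v i), ?_⟩, fun x => ?_⟩
  · rintro _ R rfl a
    exact h x₀ R a
  · simp_rw [h]
    exact ⟨fun a => integrable_const_add_sum_rotation_mul _ _, fun a a' => by
      rw [integral_const_add_sum_rotation_mul hd, integral_const_add_sum_rotation_mul hd]⟩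

theorem condBoxA_transformsFundamentally_and_unbiased {d : ℕ} (hd : 2 ≤ d)
    {P : Fin 2 → Fin 2 → Direction d → Direction d → ℝ} {b : Fin 2} {y : Direction d} {h : ℝ}
    {v : Fin d → ℝ} (hP : ∀ a x, P a b x y = h + outcomeSign a * ∑ i, v i * x.1 i)
    (hpos : ∀ x, 0 < marginalB P x b y) :
    TransformsFundamentally (condBoxA P b y) ∧ Unbiased (condBoxA P b y) := by
  have hm : ∀ x, marginalB P x b y = 2 * h := fun x => by
    rw [marginalB, Fin.sum_univ_two, hP, hP, outcomeSign_zero, outcomeSign_one]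
    ring
  refine transformsFundamentally_and_unbiased_of_eq hd (fun i => v i / (2 * h)) fun a x => ?_
  have h0 : 0 < 2 * h := hm x ▸ hpos x
  have hs : ∑ i, v i / (2 * h) * x.1 i = (∑ i, v i * x.1 i) / (2 * h) := by
    rw [Finset.sum_div]
    exact Finset.sum_congr rfl fun i _ => by ring
  have h0' : h ≠ 0 := by linarith
  rw [condBoxA, hm, hP, hs]
  field_simp

/-- The coordinates of a direction in the plane singled out by `e`, as a complex number. -/
def planarPart {d n : ℕ} (e : Fin 2 ⊕ Fin n ≃ Fin d) (x : Direction d) : ℂ :=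
  ⟨x.1 (e (Sum.inl 0)), x.1 (e (Sum.inl 1))⟩

theorem planarPart_planarDirection {d n : ℕ} (e : Fin 2 ⊕ Fin n ≃ Fin d) (z : Circle) :
    planarPart e (planarDirection e z) = z := by
  apply Complex.ext <;> simp [planarPart, planarDirection]

theorem norm_planarPart_le_one {d n : ℕ} (e : Fin 2 ⊕ Fin n ≃ Fin d) (x : Direction d) :
    ‖planarPart e x‖ ≤ 1 := by
  have h : ‖x.1‖ = 1 := mem_sphere_zero_iff_norm.1 x.2
  rw [EuclideanSpace.norm_eq, Real.sqrt_eq_one, ← e.sum_comp, Fintype.sum_sum_type,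
    Fin.sum_univ_two] at h
  rw [Complex.norm_def, Real.sqrt_le_one, Complex.normSq_apply]
  simp only [Real.norm_eq_abs, sq_abs] at h
  have := Finset.sum_nonneg fun (i : Fin n) (_ : i ∈ Finset.univ) =>
    sq_nonneg (x.1 (e (Sum.inr i)))
  simp only [planarPart, ← sq]
  linarith

theorem Matrix.PosSemidef.trace_mul_nonneg {ι : Type*} [Fintype ι] {A B : Matrix ι ι ℂ}
    (hA : A.PosSemidef) (hB : B.PosSemidef) : 0 ≤ (A * B).trace := by
  obtain ⟨C, rfl⟩ : ∃ C : Matrix ι ι ℂ, A = Cᴴ * C := by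
    classical
    open scoped MatrixOrder Matrix.Norms.L2Operator in
    exact CStarAlgebra.nonneg_iff_eq_star_mul_self.mp hA.nonneg
  rw [Matrix.mul_assoc, Matrix.trace_mul_comm]
  exact (hB.mul_mul_conjTranspose_same C).trace_nonneg

/-- The box of a two-qubit state, where the Bloch vectors of the effects are the projections of the
input directions to the plane singled out by `e`. -/
def qubitBox {d n : ℕ} (e : Fin 2 ⊕ Fin n ≃ Fin d) (ρ : Matrix (Fin 2 × Fin 2) (Fin 2 × Fin 2) ℂ) :
    Fin 2 → Fin 2 → Direction d → Direction d → ℝ :=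
  fun a b x y => (ρ * (qubitEffect (outcomeSign a • planarPart e x) ⊗ₖ
    qubitEffect (outcomeSign b • planarPart e y))).trace.re

section QubitBox

variable {d n : ℕ} (e : Fin 2 ⊕ Fin n ≃ Fin d) (ρ : Matrix (Fin 2 × Fin 2) (Fin 2 × Fin 2) ℂ)

theorem sum_qubitBox_left (b : Fin 2) (x y : Direction d) : ∑ a, qubitBox e ρ a b x y =
    (ρ * (1 ⊗ₖ qubitEffect (outcomeSign b • planarPart e y))).trace.re := by
  rw [← qubitEffect_add_neg (planarPart e x), Matrix.add_kronecker, Matrix.mul_add,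
    Matrix.trace_add, Complex.add_re, Fin.sum_univ_two]
  simp [qubitBox]

theorem sum_qubitBox_right (a : Fin 2) (x y : Direction d) : ∑ b, qubitBox e ρ a b x y =
    (ρ * (qubitEffect (outcomeSign a • planarPart e x) ⊗ₖ 1)).trace.re := by
  rw [← qubitEffect_add_neg (planarPart e y), Matrix.kronecker_add, Matrix.mul_add,
    Matrix.trace_add, Complex.add_re, Fin.sum_univ_two]
  simp [qubitBox]

theorem isNoSignallingBox_qubitBox (hρ : IsDensityMatrix ρ) :
    IsNoSignallingBox (qubitBox e ρ) where
  nonneg a b x y := (Complex.le_def.1 (hρ.1.trace_mul_nonneg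
    (((isPOVM_qubitEffect (norm_planarPart_le_one e x)).1 a).kronecker
      ((isPOVM_qubitEffect (norm_planarPart_le_one e y)).1 b)))).1
  sum_eq_one x y := by
    simp_rw [sum_qubitBox_right]
    rw [← Complex.re_sum, ← Matrix.trace_sum, ← Matrix.mul_sum, Fin.sum_univ_two,
      ← Matrix.add_kronecker, outcomeSign_zero, outcomeSign_one, one_smul, neg_one_smul,
      qubitEffect_add_neg, Matrix.one_kronecker_one, Matrix.mul_one, hρ.2, Complex.one_re]
  noSignal_A a x y y' := by rw [sum_qubitBox_right, sum_qubitBox_right]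
  noSignal_B b y x x' := by rw [sum_qubitBox_left, sum_qubitBox_left]

/-- A linear functional of the effects of `qubitBox` is, up to a constant term independent of the
outcome, the sign of the outcome times a linear function of the direction. -/
theorem exists_linear_qubitEffect (L : Matrix (Fin 2) (Fin 2) ℂ →ₗ[ℂ] ℂ) :
    ∃ (h : ℝ) (v : Fin d → ℝ), ∀ (a : Fin 2) (x : Direction d),
      (L (qubitEffect (outcomeSign a • planarPart e x))).re =
        h + outcomeSign a * ∑ i, v i * x.1 i := by
  refine ⟨(L 1).re / 2, fun i => Sum.elim
    ![(L (qubitObservable 1)).re / 2, (L (qubitObservable Complex.I)).re / 2] 0 (e.symm i),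
    fun a x => ?_⟩
  have hz : ∀ z : ℂ, qubitObservable z =
      (z.re : ℂ) • qubitObservable 1 + (z.im : ℂ) • qubitObservable Complex.I := by
    intro z
    ext i j
    fin_cases i <;> fin_cases j <;> simp [qubitObservable]
  rw [qubitEffect_eq_smul_one_add, hz, ← e.sum_comp, Fintype.sum_sum_type, Fin.sum_univ_two]
  simp [planarPart]
  ring

theorem allConditionalBoxes_qubitBox (hd : 2 ≤ d) :
    AllConditionalBoxes (fun Q => TransformsFundamentally Q ∧ Unbiased Q)
      (fun Q => TransformsFundamentally Q ∧ Unbiased Q) (qubitBox e ρ) := by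
  constructor
  · intro b y hpos
    obtain ⟨h, v, hv⟩ := exists_linear_qubitEffect e
      { toFun := fun A => (ρ * (A ⊗ₖ qubitEffect (outcomeSign b • planarPart e y))).trace
        map_add' := fun A B => by rw [Matrix.add_kronecker, Matrix.mul_add, Matrix.trace_add]
        map_smul' := fun c A => by
          rw [Matrix.smul_kronecker, Matrix.mul_smul, Matrix.trace_smul, RingHom.id_apply] }
    exact condBoxA_transformsFundamentally_and_unbiased hd hv hpos
  · intro a x hpos
    obtain ⟨h, v, hv⟩ := exists_linear_qubitEffect e
      { toFun := fun A => (ρ * (qubitEffect (outcomeSign a • planarPart e x) ⊗ₖ A)).trace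
        map_add' := fun A B => by rw [Matrix.kronecker_add, Matrix.mul_add, Matrix.trace_add]
        map_smul' := fun c A => by
          rw [Matrix.kronecker_smul, Matrix.mul_smul, Matrix.trace_smul, RingHom.id_apply] }
    exact condBoxA_transformsFundamentally_and_unbiased (P := swapParties (qubitBox e ρ)) hd hv hpos

end QubitBox

theorem mem_boxBehaviours_of_qubit {d : ℕ} (hd : 2 ≤ d)
    {ρ : Matrix (Fin 2 × Fin 2) (Fin 2 × Fin 2) ℂ} (hρ : IsDensityMatrix ρ) (z w : Fin 2 → Circle) :
    (fun a b r t => (ρ * (qubitEffect (outcomeSign a • (z r : ℂ)) ⊗ₖ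
      qubitEffect (outcomeSign b • (w t : ℂ)))).trace.re : Table222) ∈ boxBehaviours d := by
  obtain ⟨n, rfl⟩ := Nat.exists_eq_add_of_le hd
  let e : Fin 2 ⊕ Fin n ≃ Fin (2 + n) := finSumFinEquiv
  have h := allConditionalBoxes_qubitBox e ρ hd
  refine ⟨qubitBox e ρ, isNoSignallingBox_qubitBox e ρ hρ,
    ⟨fun b y hp => (h.1 b y hp).1, fun a x hp => (h.2 a x hp).1⟩,
    ⟨fun b y hp => (h.1 b y hp).2, fun a x hp => (h.2 a x hp).2⟩,
    fun r => planarDirection e (z r), fun t => planarDirection e (w t), fun a b r t => ?_⟩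
  simp only [qubitBox, planarPart_planarDirection]

/-! ### From quantum behaviours to boxes -/

/-- The normalisation of a positive operator; for the zero operator the state is arbitrary. -/
theorem exists_density_smul_eq {τ : Matrix (Fin 2 × Fin 2) (Fin 2 × Fin 2) ℂ} (hτ : τ.PosSemidef) :
    ∃ ρ, IsDensityMatrix ρ ∧ τ = τ.trace.re • ρ := by
  have htr : (τ.trace.re : ℂ) = τ.trace :=
    Complex.ext rfl (by simpa using (Complex.le_def.1 hτ.trace_nonneg).2)
  by_cases h0 : τ.trace.re = 0
  · refine ⟨Matrix.diagonal fun i => if i = 0 then 1 else 0,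
      ⟨Matrix.PosSemidef.diagonal ?_, ?_⟩, ?_⟩
    · intro i
      simp only [Pi.zero_apply]
      split_ifs <;> simp
    · simp [Matrix.trace_diagonal]
    · rw [h0, zero_smul]
      rw [h0] at htr
      exact hτ.trace_eq_zero_iff.1 htr.symm
  · refine ⟨τ.trace.re⁻¹ • τ, ⟨hτ.smul (inv_nonneg.2 (Complex.le_def.1 hτ.trace_nonneg).1), ?_⟩, ?_⟩
    · rw [Matrix.trace_smul, Complex.real_smul, ← htr]
      rw [Complex.ofReal_re]
      exact_mod_cast inv_mul_cancel₀ h0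
    · rw [smul_smul, mul_inv_cancel₀ h0, one_smul]

theorem quantumBehaviours_subset_mixtures {d : ℕ} (hd : 2 ≤ d) :
    quantumBehaviours ⊆ sharedRandomnessMixtures (boxBehaviours d) := by
  rintro p ⟨m, n, ρ, E, F, hρ, hE, hF, hp⟩
  obtain ⟨κ, _, A, z, hA⟩ := exists_kraus_of_isPOVM hE
  obtain ⟨l, _, B, w, hB⟩ := exists_kraus_of_isPOVM hF
  let C : κ × l → Matrix (Fin 2 × Fin 2) (Fin m × Fin n) ℂ := fun k => A k.1 ⊗ₖ B k.2
  have hτ : ∀ k, (C k * ρ * (C k)ᴴ).PosSemidef := fun k => hρ.1.mul_mul_conjTranspose_same _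
  choose σ hσ hτσ using fun k => exists_density_smul_eq (hτ k)
  -- the state after the local operations with outcomes `k` takes the place of `ρ`
  have hpk : ∀ a b r t, p a b r t = ∑ k, (C k * ρ * (C k)ᴴ).trace.re *
      (σ k * (qubitEffect (outcomeSign a • (z k.1 r : ℂ)) ⊗ₖ
        qubitEffect (outcomeSign b • (w k.2 t : ℂ)))).trace.re := by
    intro a b r t
    have h : (p a b r t : ℂ) = ∑ k, (C k * ρ * (C k)ᴴ *
        (qubitEffect (outcomeSign a • (z k.1 r : ℂ)) ⊗ₖ
          qubitEffect (outcomeSign b • (w k.2 t : ℂ)))).trace := by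
      rw [hp, hA, hB, Fintype.sum_prod_type]
      have hk : (∑ k, (A k)ᴴ * qubitEffect (outcomeSign a • (z k r : ℂ)) * A k) ⊗ₖ
          (∑ k, (B k)ᴴ * qubitEffect (outcomeSign b • (w k t : ℂ)) * B k) =
          ∑ k, ∑ j, ((A k)ᴴ * qubitEffect (outcomeSign a • (z k r : ℂ)) * A k) ⊗ₖ
            ((B j)ᴴ * qubitEffect (outcomeSign b • (w j t : ℂ)) * B j) := by
        ext ⟨i, i'⟩ ⟨j, j'⟩
        simp only [Matrix.kronecker_apply, Matrix.sum_apply, Finset.sum_mul_sum]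
      rw [hk, Matrix.mul_sum, Matrix.trace_sum]
      refine Finset.sum_congr rfl fun k _ => ?_
      rw [Matrix.mul_sum, Matrix.trace_sum]
      refine Finset.sum_congr rfl fun j _ => ?_
      rw [Matrix.mul_kronecker_mul, Matrix.mul_kronecker_mul, ← Matrix.conjTranspose_kronecker,
        ← Matrix.mul_assoc, Matrix.trace_mul_comm]
      simp only [C, Matrix.mul_assoc]
    have h' := congrArg Complex.re h
    rw [Complex.ofReal_re, Complex.re_sum] at h'
    rw [h']
    refine Finset.sum_congr rfl fun k _ => ?_
    conv_lhs => rw [hτσ k]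
    rw [Matrix.smul_mul, Matrix.trace_smul, Complex.smul_re, smul_eq_mul]
  refine mem_sharedRandomnessMixtures (fun k => (Complex.le_def.1 (hτ k).trace_nonneg).1) ?_
    (fun k => mem_boxBehaviours_of_qubit hd (hσ k) (z k.1) (w k.2)) hpk
  have hone : ∑ a, ∑ b, p a b 0 0 = 1 := by
    have h : ((∑ a, ∑ b, p a b 0 0 : ℝ) : ℂ) = 1 := by
      push_cast
      simp only [hp, Fin.sum_univ_two, ← Matrix.trace_add, ← Matrix.mul_add, ← Matrix.kronecker_add,
        ← Matrix.add_kronecker]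
      have hE1 := (hE 0).2
      have hF1 := (hF 0).2
      rw [Fin.sum_univ_two] at hE1 hF1
      rw [hE1, hF1, Matrix.one_kronecker_one, Matrix.mul_one, hρ.2]
    exact_mod_cast h
  rw [← hone]
  simp_rw [hpk]
  have hbox : ∀ k, ∑ a, ∑ b, (σ k * (qubitEffect (outcomeSign a • (z k.1 0 : ℂ)) ⊗ₖ
        qubitEffect (outcomeSign b • (w k.2 0 : ℂ)))).trace.re = 1 := by
    intro k
    obtain ⟨P, hP, -, -, x, y, h⟩ := mem_boxBehaviours_of_qubit hd (hσ k) (z k.1) (w k.2)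
    simp only [h]
    exact hP.sum_eq_one _ _
  have : ∀ a, ∑ b, ∑ k, (C k * ρ * (C k)ᴴ).trace.re *
      (σ k * (qubitEffect (outcomeSign a • (z k.1 0 : ℂ)) ⊗ₖ
        qubitEffect (outcomeSign b • (w k.2 0 : ℂ)))).trace.re = _ := fun a => Finset.sum_comm
  simp_rw [this]
  rw [Finset.sum_comm]
  refine Finset.sum_congr rfl fun k _ => ?_
  simp_rw [← Finset.mul_sum]
  rw [hbox, mul_one]

theorem theorem3 (d : ℕ) (hd : 2 ≤ d) :
    quantumBehaviours = sharedRandomnessMixtures (boxBehaviours d) := by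
  apply Set.Subset.antisymm (quantumBehaviours_subset_mixtures hd)
  exact (sharedRandomnessMixtures_mono (boxBehaviours_subset_quantumBehaviours hd)).trans
    sharedRandomnessMixtures_quantumBehaviours_subset

end
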